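/- Let $m>n\ge 1$, $y^*\in\mathbb R^m$, $\sigma>0$, let $\Pi\subset\mathbb R^n$ be convex and compact, and let $\Theta\subset\mathbb R^{m\times n}\times\mathbb R^m$ be compact. For $\theta=(A,b)$ consider the single-state affine system $$y_t=Ax_t+b+w_t,\qquad t=1,2,\dots,$$ where $x_t\in\mathbb R^n$ is the input, $y_t\in\mathbb R^m$ is the output, and the noise vectors $w_t\in\mathbb R^m$ are i.i.d. with a law $F$ in the class $\mathcal F$ of probability laws on $\mathbb R^m$ such that $\mathbb E\,w_{t,i}=0$, $\mathbb E\,w_{t,i}^2\le\sigma^2$ and $\mathbb E\,w_{t,i}^4\le\sigma^4$ for all $i$. For $A$ of full column rank, the stage cost $J_{\theta,F}(x)=\mathbb E\|y^*-(Ax+b+w_t)\|_2^2$ is minimized at the optimal input $x^*(\theta)=(A^{\mathsf T}A)^{-1}A^{\mathsf T}(y^*-b)$. Let $\Theta_0$ be the set of all $\theta=(A,b)\in\Theta$ such that $A$ has full column rank and $x^*(\theta)\in\Pi$, and assume that $\Theta_0$ has nonempty interior. A policy $\mu$ chooses each input $x_t^\mu\in\mathbb R^n$ as a measurable function of the past $(x_1,\dots,x_{t-1},y_1,\dots,y_{t-1})$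 and, possibly, of a random seed independent of the noise. A sequence of estimates $\hat x^\mu_t\in\mathbb R^n$ is any sequence of measurable functions of the same information. With expectations taken when $\mu$ is run on the system with parameter $\theta$ and noise law $F$, put $$\hat{\mathcal E}_T^\mu=\sup_{\theta\in\Theta_0,\,F\in\mathcal F}\mathbb E\sum_{t=1}^T\|\hat x_t^\mu-x^*(\theta)\|_2^2,\qquad \bar{\mathcal E}_T^\mu=\sup_{\theta\in\Theta_0,\,F\in\mathcal F}\mathbb E\sum_{t=1}^T\|x_t^\mu-x^*(\theta)\|_2^2,$$ $$\bar{\mathcal R}_T^\mu=\sup_{\theta\in\Theta_0,\,F\in\mathcal F}\mathbb E\Big(\sum_{t=1}^T J_{\theta,F}(x_t^\mu)-\sum_{t=1}^T J_{\theta,F}(x^*(\theta))\Big),$$ with values in $[0,\infty]$. Then there are constants $C,C',C''>0$ (depending only on $m,n,y^*,\sigma,\Pi,\Theta$) such that, for every policy $\mu$, every sequence of estimates $(\hat x_t^\mu)$ and every horizon $T$, $$\hat{\mathcal E}_T^\mu\,\bar{\mathcal E}_T^\mu\ge CT,\qquad \bar{\mathcal E}_T^\mu\ge C'\sqrt T,\qquad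 \bar{\mathcal R}_T^\mu\ge C''\sqrt T.$$ -/

import Mathlib

open MeasureTheory ProbabilityTheory Matrix
open scoped ENNReal

namespace AffineRegulation

noncomputable section

/-- The Euclidean space `ℝᵈ`. -/
abbrev Vec (d : ℕ) : Type := EuclideanSpace ℝ (Fin d)

/-- System parameters `θ = (A, b)` with `A ∈ ℝ^{m × n}` and `b ∈ ℝᵐ`. -/
abbrev Param (m n : ℕ) : Type := Matrix (Fin m) (Fin n) ℝ × Vec m

/-- The noiseless output `A x + b`. -/
def meanOutput {m n : ℕ} (θ : Param m n) (x : Vec n) : Vec m :=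
  WithLp.toLp 2 (θ.1 *ᵥ x.ofLp) + θ.2

/-- The optimal input `x*(θ) = (AᵀA)⁻¹ Aᵀ (y* - b)` of a decision maker who knows `θ`. -/
def optimalInput {m n : ℕ} (ystar : Vec m) (θ : Param m n) : Vec n :=
  WithLp.toLp 2 ((θ.1ᵀ * θ.1)⁻¹ *ᵥ (θ.1ᵀ *ᵥ (ystar - θ.2).ofLp))

/-- The parameters in `Θ` over which the worst case is taken: `A` has full column rank and the
optimal input lies in the set `D` known to the decision maker. -/
def admissibleParams {m n : ℕ} (ystar : Vec m) (D : Set (Vec n)) (Θ : Set (Param m n)) :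
    Set (Param m n) :=
  {θ | θ ∈ Θ ∧ θ.1.rank = n ∧ optimalInput ystar θ ∈ D}

/-- The noise laws: zero mean, second moment of every entry at most `σ²` and fourth moment of every
entry at most `σ⁴`. -/
def noiseLaws (m : ℕ) (σ : ℝ) : Set (ProbabilityMeasure (Vec m)) :=
  {F | ∀ i : Fin m,
    Integrable (fun w : Vec m => w i ^ 4) (F : Measure (Vec m)) ∧
    ∫ w, w i ∂(F : Measure (Vec m)) = 0 ∧
    ∫ w, w i ^ 2 ∂(F : Measure (Vec m)) ≤ σ ^ 2 ∧
    ∫ w, w i ^ 4 ∂(F : Measure (Vec m)) ≤ σ ^ 4}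

/-- A sequence of (possibly randomized) decision rules with values in `ℝⁿ`. The rule with index `t`
(period `t + 1`) sees the private random seed, drawn once from `S`, and the `t` input-output pairs
of the preceding periods. Policies and sequences of estimates are both of this form. -/
structure DecisionRules (m n : ℕ) (S : Type*) [MeasurableSpace S] where
  rule : (t : ℕ) → S → (Fin t → Vec n × Vec m) → Vec n
  measurable_rule : ∀ t, Measurable fun p : S × (Fin t → Vec n × Vec m) => rule t p.1 p.2

section Dynamics

variable {m n : ℕ} {S : Type*} [MeasurableSpace S]

/-- The first `t` input-output pairs when policy `μ` is run on the system `y = A x + b + w` with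
seed `u` and noise sequence `w`. -/
def history (μ : DecisionRules m n S) (θ : Param m n) (u : S) (w : ℕ → Vec m) :
    (t : ℕ) → Fin t → Vec n × Vec m
  | 0 => Fin.elim0
  | t + 1 =>
    Fin.snoc (α := fun _ => Vec n × Vec m) (history μ θ u w t)
      (μ.rule t u (history μ θ u w t),
        meanOutput θ (μ.rule t u (history μ θ u w t)) + w t)

/-- The value of the rules `e` at index `t` on the history generated by the policy `μ`. -/
def output (μ e : DecisionRules m n S) (θ : Param m n) (u : S) (w : ℕ → Vec m) (t : ℕ) : Vec n :=
  e.rule t u (history μ θ u w t)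

/-- Joint law of the seed and of the noise: the noise is i.i.d. with law `F` and independent of
the seed. -/
def jointLaw (ν : Measure S) (F : ProbabilityMeasure (Vec m)) : Measure (S × (ℕ → Vec m)) :=
  ν.prod (Measure.infinitePi fun _ : ℕ => (F : Measure (Vec m)))

/-- Expected cumulative squared distance to the optimal input, over `T` periods, of the estimates
`e` computed from the observations of policy `μ`. -/
def cumulativeMSE (ystar : Vec m) (ν : Measure S) (μ e : DecisionRules m n S) (T : ℕ)
    (θ : Param m n) (F : ProbabilityMeasure (Vec m)) : ℝ≥0∞ :=
  ∫⁻ ω, ∑ t ∈ Finset.range T,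
    ENNReal.ofReal (‖output μ e θ ω.1 ω.2 t - optimalInput ystar θ‖ ^ 2) ∂jointLaw ν F

/-- The stage cost `E ‖y* - y‖²` of the input `x`, where `y = A x + b + w` and `w` has law `F`. -/
def stageCost (ystar : Vec m) (θ : Param m n) (F : ProbabilityMeasure (Vec m)) (x : Vec n) : ℝ :=
  ∫ w, ‖ystar - (meanOutput θ x + w)‖ ^ 2 ∂(F : Measure (Vec m))

/-- The stage cost is the noiseless squared error plus the total variance of the noise. -/
theorem stageCost_eq {m n : ℕ} {σ : ℝ} (ystar : Vec m) (θ : Param m n)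
    {F : ProbabilityMeasure (Vec m)} (hF : F ∈ noiseLaws m σ) (x : Vec n) :
    stageCost ystar θ F x =
      ‖ystar - meanOutput θ x‖ ^ 2 + ∑ i, ∫ w, w i ^ 2 ∂(F : Measure (Vec m)) := by
  have hmeas : ∀ i : Fin m, AEStronglyMeasurable (fun w : Vec m => w i) (F : Measure (Vec m)) :=
    fun i => (by fun_prop : Measurable fun w : Vec m => w i).aestronglyMeasurable
  have h2 : ∀ i : Fin m, Integrable (fun w : Vec m => w i ^ 2) (F : Measure (Vec m)) := by
    intro i
    refine ((integrable_const (1 : ℝ)).add (hF i).1).mono ((hmeas i).pow 2) ?_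
    refine Filter.Eventually.of_forall fun w => ?_
    simp only [Pi.add_apply, Real.norm_eq_abs]
    rw [abs_of_nonneg (by positivity), abs_of_nonneg (by positivity)]
    nlinarith [sq_nonneg (w i ^ 2 - 1)]
  have h1 : ∀ i : Fin m, Integrable (fun w : Vec m => w i) (F : Measure (Vec m)) := by
    intro i
    refine ((integrable_const (1 : ℝ)).add (h2 i)).mono (hmeas i) ?_
    refine Filter.Eventually.of_forall fun w => ?_
    simp only [Pi.add_apply, Real.norm_eq_abs]
    rw [abs_of_nonneg (a := 1 + _) (by positivity)]
    exact abs_le.2 ⟨by nlinarith [sq_nonneg (w i + 1)], by nlinarith [sq_nonneg (w i - 1)]⟩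
  set v : Vec m := ystar - meanOutput θ x with hv
  have hpt : ∀ w : Vec m, ‖ystar - (meanOutput θ x + w)‖ ^ 2 =
      ∑ i, (v i ^ 2 - 2 * v i * w i + w i ^ 2) := by
    intro w
    rw [← sub_sub, ← hv, EuclideanSpace.real_norm_sq_eq]
    exact Finset.sum_congr rfl fun i _ => by simp only [PiLp.sub_apply]; ring
  have hi : ∀ i : Fin m, Integrable (fun w : Vec m => v i ^ 2 - 2 * v i * w i)
      (F : Measure (Vec m)) := fun i => (integrable_const _).sub ((h1 i).const_mul _)
  unfold stageCost
  simp only [hpt]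
  rw [integral_finsetSum _ fun i _ => Integrable.fun_add (hi i) (h2 i),
    EuclideanSpace.real_norm_sq_eq,
    ← Finset.sum_add_distrib]
  refine Finset.sum_congr rfl fun i _ => ?_
  rw [integral_add (hi i) (h2 i), integral_sub (integrable_const _) ((h1 i).const_mul _),
    integral_const_mul, (hF i).2.1]
  simp

/-- The optimal input minimizes the stage cost. -/
theorem stageCost_optimalInput_le {m n : ℕ} {σ : ℝ} (ystar : Vec m) (θ : Param m n)
    (hθ : θ.1.rank = n) {F : ProbabilityMeasure (Vec m)} (hF : F ∈ noiseLaws m σ) (x : Vec n) :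
    stageCost ystar θ F (optimalInput ystar θ) ≤ stageCost ystar θ F x := by
  rw [stageCost_eq ystar θ hF, stageCost_eq ystar θ hF]
  gcongr ?_ + _
  obtain ⟨A, b⟩ := θ
  simp only at hθ
  have hunit : IsUnit (Aᵀ * A).det := by
    have hr : (Aᵀ * A).rank = n := by rw [Matrix.rank_transpose_mul_self, hθ]
    rw [← Matrix.isUnit_iff_isUnit_det, ← Matrix.mulVec_surjective_iff_isUnit]
    exact LinearMap.range_eq_top.1 (Submodule.eq_top_of_finrank_eq
      (S := LinearMap.range (Aᵀ * A).mulVecLin) (by simpa [Matrix.rank] using hr))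
  set z := optimalInput ystar (A, b) with hz
  have hfoc : Aᵀ *ᵥ ((ystar - meanOutput (A, b) z).ofLp) = 0 := by
    have : (ystar - meanOutput (A, b) z).ofLp = (ystar - b).ofLp - A *ᵥ z.ofLp := by
      simp only [meanOutput, WithLp.ofLp_sub, WithLp.ofLp_add]; abel
    rw [this, Matrix.mulVec_sub, hz, optimalInput, Matrix.mulVec_mulVec,
      Matrix.mulVec_mulVec, Matrix.mul_nonsing_inv _ hunit, Matrix.one_mulVec, sub_self]
  have hdiff : ystar - meanOutput (A, b) x =
      (ystar - meanOutput (A, b) z) + WithLp.toLp 2 (A *ᵥ (z - x).ofLp) := by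
    simp only [meanOutput, WithLp.ofLp_sub, Matrix.mulVec_sub, WithLp.toLp_sub]; abel
  have horth : inner ℝ (ystar - meanOutput (A, b) z) (WithLp.toLp 2 (A *ᵥ (z - x).ofLp)) = 0 := by
    rw [EuclideanSpace.inner_eq_star_dotProduct, star_trivial, dotProduct_comm,
      Matrix.dotProduct_mulVec, ← Matrix.mulVec_transpose, hfoc, zero_dotProduct]
  rw [hdiff, norm_add_sq_real, horth]
  nlinarith [sq_nonneg ‖WithLp.toLp 2 (A *ᵥ (z - x).ofLp)‖]

/-- The regret: the expected excess over `T` periods of the cumulative stage cost of policy `μ` over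
that of the optimal input. The excess is nonnegative (`stageCost_optimalInput_le`), so
`ENNReal.ofReal` does not truncate. -/
def regret (ystar : Vec m) (ν : Measure S) (μ : DecisionRules m n S) (T : ℕ)
    (θ : Param m n) (F : ProbabilityMeasure (Vec m)) : ℝ≥0∞ :=
  ∫⁻ ω, ENNReal.ofReal
    (∑ t ∈ Finset.range T, stageCost ystar θ F (output μ μ θ ω.1 ω.2 t) -
      ∑ _t ∈ Finset.range T, stageCost ystar θ F (optimalInput ystar θ)) ∂jointLaw ν F

/-- The worst-case cumulative estimation-MSE of the estimates `e` under policy `μ`. -/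
def worstEstimationMSE (ystar : Vec m) (D : Set (Vec n)) (Θ : Set (Param m n)) (σ : ℝ)
    (ν : Measure S) (μ e : DecisionRules m n S) (T : ℕ) : ℝ≥0∞ :=
  ⨆ θ ∈ admissibleParams ystar D Θ, ⨆ F ∈ noiseLaws m σ, cumulativeMSE ystar ν μ e T θ F

/-- The worst-case cumulative input-MSE of policy `μ`. -/
def worstInputMSE (ystar : Vec m) (D : Set (Vec n)) (Θ : Set (Param m n)) (σ : ℝ)
    (ν : Measure S) (μ : DecisionRules m n S) (T : ℕ) : ℝ≥0∞ :=
  ⨆ θ ∈ admissibleParams ystar D Θ, ⨆ F ∈ noiseLaws m σ, cumulativeMSE ystar ν μ μ T θ F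

/-- The worst-case regret of policy `μ`. -/
def worstRegret (ystar : Vec m) (D : Set (Vec n)) (Θ : Set (Param m n)) (σ : ℝ)
    (ν : Measure S) (μ : DecisionRules m n S) (T : ℕ) : ℝ≥0∞ :=
  ⨆ θ ∈ admissibleParams ystar D Θ, ⨆ F ∈ noiseLaws m σ, regret ystar ν μ T θ F

end Dynamics

end

end AffineRegulation

/-!
Inputs close to the optimal one are uninformative. Take an interior parameter `θ = (A, b)` whose
optimal input `x₀` leaves a residual `r ≠ 0`, necessarily orthogonal to the range of `A`; such a
parameter exists because `n < m`. Add the rank-one matrix `s ρ vᵀ` to `A`, with `ρ` a small multiple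
of `r`, and correct `b` so that the mean output at `x₀` does not change. For small `s` the optimal
input moves at a speed bounded below, whereas the mean output at `x` changes only by
`s ⟪v, x - x₀⟫ ρ`.

Let the noise be Gaussian on the line spanned by `ρ`. By a discrete Girsanov formula, the
information about `s` collected up to time `T` is at most `s² ‖v‖²` times the cumulative squared
distance of the inputs from `x₀`, hence at most `s² ‖v‖² X` with `X` the largest cumulative input
error along the curve. As long as this is at most one, Le Cam's two-point argument shows that no
estimate can distinguish `0` from `s`, and the cumulative estimation error is at least a multiple
of `s² T`. Taking `s²` of order `1 / X` gives the product bound. Applied to the inputs as estimates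
of themselves it gives the bound of order `√T`, and since the excess stage cost of `x` is
`‖A (x - x₀)‖²`, the regret dominates the input error.
-/

namespace AffineRegulation

noncomputable section

section Resampling

theorem measurePreserving_update_infinitePi {ι : Type*} [DecidableEq ι] {X : ι → Type*}
    [∀ i, MeasurableSpace (X i)] (μ : ∀ i, Measure (X i)) [∀ i, IsProbabilityMeasure (μ i)]
    (t : ι) :
    MeasurePreserving (fun q : (∀ i, X i) × X t => Function.update q.1 t q.2)
      ((Measure.infinitePi μ).prod (μ t)) (Measure.infinitePi μ) := by
  have hupd : Measurable fun q : (∀ i, X i) × X t => Function.update q.1 t q.2 :=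
    measurable_update'
  refine ⟨hupd, Measure.eq_infinitePi _ fun s B hB => ?_⟩
  have hpre : (fun q : (∀ i, X i) × X t => Function.update q.1 t q.2) ⁻¹' Set.pi s B =
      Set.pi (s.erase t) B ×ˢ {z | t ∈ s → z ∈ B t} := by
    ext q
    simp only [Set.mem_preimage, Set.update_mem_pi_iff, Finset.mem_coe, Finset.coe_erase,
      Set.mem_prod, Set.mem_ofPred_eq]
  rw [Measure.map_apply hupd (MeasurableSet.pi s.countable_toSet fun i _ => hB i), hpre,
    Measure.prod_prod, Measure.infinitePi_pi _ fun i _ => hB i]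
  by_cases ht : t ∈ s
  · simp only [ht, forall_const, Set.ofPred_mem_eq]
    rw [mul_comm, Finset.mul_prod_erase s (fun i => μ i (B i)) ht]
  · simp [ht]

variable {m : ℕ} {S β : Type*} {t : ℕ}

/-- The value of `f` is determined by the seed and by the noise of the periods before `t`. -/
def IsNonanticipating (t : ℕ) (f : S × (ℕ → Vec m) → β) : Prop :=
  ∀ u, DependsOn (fun w => f (u, w)) (Set.Iio t)

theorem IsNonanticipating.mono {s : ℕ} (hst : s ≤ t) {f : S × (ℕ → Vec m) → β}
    (hf : IsNonanticipating s f) : IsNonanticipating t f :=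
  fun u => (hf u).mono (Set.Iio_subset_Iio hst)

theorem IsNonanticipating.apply_update {f : S × (ℕ → Vec m) → β}
    (hf : IsNonanticipating t f) (p : S × (ℕ → Vec m)) (z : Vec m) :
    f (p.1, Function.update p.2 t z) = f p :=
  hf p.1 fun _ hi => Function.update_of_ne (ne_of_lt hi) _ _

variable [MeasurableSpace S]

instance isProbabilityMeasure_jointLaw (ν : Measure S) [IsProbabilityMeasure ν]
    (F : ProbabilityMeasure (Vec m)) : IsProbabilityMeasure (jointLaw ν F) := by
  unfold jointLaw; infer_instance

theorem measurePreserving_update_jointLaw (ν : Measure S) [IsProbabilityMeasure ν]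
    (F : ProbabilityMeasure (Vec m)) (t : ℕ) :
    MeasurePreserving
      (fun q : (S × (ℕ → Vec m)) × Vec m => (q.1.1, Function.update q.1.2 t q.2))
      ((jointLaw ν F).prod (F : Measure (Vec m))) (jointLaw ν F) :=
  ((MeasurePreserving.id ν).prod (measurePreserving_update_infinitePi _ t)).comp
    (measurePreserving_prodAssoc ν _ _)

theorem lintegral_jointLaw_eq_lintegral_update (ν : Measure S) [IsProbabilityMeasure ν]
    (F : ProbabilityMeasure (Vec m)) (t : ℕ) {f : S × (ℕ → Vec m) → ℝ≥0∞} (hf : Measurable f) :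
    ∫⁻ p, f p ∂jointLaw ν F =
      ∫⁻ p, ∫⁻ z, f (p.1, Function.update p.2 t z) ∂(F : Measure (Vec m)) ∂jointLaw ν F := by
  have hmp := measurePreserving_update_jointLaw ν F t
  rw [← hmp.lintegral_comp hf]
  exact lintegral_prod _ (hf.comp hmp.measurable).aemeasurable

theorem measurePreserving_noise_jointLaw (ν : Measure S) [IsProbabilityMeasure ν]
    (F : ProbabilityMeasure (Vec m)) (t : ℕ) :
    MeasurePreserving (fun p : S × (ℕ → Vec m) => p.2 t) (jointLaw ν F) F :=
  (measurePreserving_eval_infinitePi _ t).comp measurePreserving_snd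

theorem IsNonanticipating.indepFun_noise {β : Type*} [MeasurableSpace β] (ν : Measure S)
    [IsProbabilityMeasure ν] (F : ProbabilityMeasure (Vec m)) {t : ℕ} {f : S × (ℕ → Vec m) → β}
    (hf : IsNonanticipating t f) (hfm : Measurable f) :
    IndepFun f (fun p => p.2 t) (jointLaw ν F) := by
  have hupd := measurePreserving_update_jointLaw ν F t
  have hnoise := measurePreserving_noise_jointLaw ν F t
  have hpair : (fun p : S × (ℕ → Vec m) => (f p, p.2 t)) ∘
      (fun q : (S × (ℕ → Vec m)) × Vec m => (q.1.1, Function.update q.1.2 t q.2)) =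
      Prod.map f id := by
    funext q
    simp only [Function.comp_apply, hf.apply_update, Function.update_self, Prod.map, id_eq]
  rw [indepFun_iff_map_prod_eq_prod_map_map hfm.aemeasurable hnoise.measurable.aemeasurable,
    hnoise.map_eq]
  nth_rewrite 1 [← hupd.map_eq]
  rw [Measure.map_map (hfm.prodMk hnoise.measurable) hupd.measurable, hpair,
    ← Measure.map_prod_map _ _ hfm measurable_id, Measure.map_id]

end Resampling

section LineGaussian

open Topology

theorem lintegral_const_add_gaussianReal (μ : ℝ) {v : NNReal} (hv : v ≠ 0) (a : ℝ)
    {f : ℝ → ℝ≥0∞} (hf : Measurable f) :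
    ∫⁻ z, f (a + z) ∂gaussianReal μ v =
      ∫⁻ z, f z * ENNReal.ofReal (Real.exp ((a * (z - μ) - a ^ 2 / 2) / v))
        ∂gaussianReal μ v := by
  rw [← lintegral_map (f := f) (g := (a + ·)) hf (by fun_prop), gaussianReal_map_const_add,
    gaussianReal_of_var_ne_zero _ hv, gaussianReal_of_var_ne_zero _ hv,
    lintegral_withDensity_eq_lintegral_mul _ (measurable_gaussianPDF _ _) hf,
    lintegral_withDensity_eq_lintegral_mul _ (measurable_gaussianPDF _ _) (by fun_prop)]
  refine lintegral_congr fun z => ?_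
  have hexponent : -(z - (μ + a)) ^ 2 / (2 * (v : ℝ)) =
      -(z - μ) ^ 2 / (2 * (v : ℝ)) + (a * (z - μ) - a ^ 2 / 2) / v := by
    field_simp
    ring
  simp only [Pi.mul_apply, gaussianPDF, gaussianPDFReal]
  rw [hexponent, Real.exp_add, ← mul_assoc, ENNReal.ofReal_mul (by positivity), mul_right_comm,
    mul_assoc]

theorem integrable_pow_gaussianReal (μ : ℝ) (v : NNReal) (k : ℕ) :
    Integrable (fun z : ℝ => z ^ k) (gaussianReal μ v) := by
  rcases eq_or_ne k 0 with rfl | hk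
  · simp
  · have h := (memLp_id_gaussianReal (μ := μ) (v := v) k).integrable_norm_pow (p := k) hk
    simpa only [id_eq, ← norm_pow, integrable_norm_iff (by fun_prop :
      AEStronglyMeasurable (fun z : ℝ => z ^ k) (gaussianReal μ v))] using h

variable {E : Type*} [NormedAddCommGroup E] [InnerProductSpace ℝ E]

/-- The coefficient of `ρ` in the orthogonal projection of `w` onto the line spanned by `ρ`. -/
def lineCoord (ρ w : E) : ℝ := inner ℝ ρ w / ‖ρ‖ ^ 2

theorem lineCoord_smul {ρ : E} (hρ : ρ ≠ 0) (z : ℝ) : lineCoord ρ (z • ρ) = z := by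
  rw [lineCoord, inner_smul_right, real_inner_self_eq_norm_sq,
    mul_div_cancel_right₀ z (by simpa using hρ)]

variable [MeasurableSpace E] [BorelSpace E]

/-- The law of `z • ρ` with `z` standard normal: a centred Gaussian law carried by the line spanned
by `ρ`. -/
def lineGaussian (ρ : E) : ProbabilityMeasure E :=
  ⟨(gaussianReal 0 1).map fun z : ℝ => z • ρ,
    Measure.isProbabilityMeasure_map (by fun_prop)⟩

@[fun_prop]
theorem measurable_lineCoord (ρ : E) : Measurable (lineCoord ρ) := by
  unfold lineCoord
  exact Continuous.measurable (by fun_prop)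

theorem integral_lineGaussian (ρ : E) {f : E → ℝ} (hf : Measurable f) :
    ∫ w, f w ∂(lineGaussian ρ : Measure E) = ∫ z, f (z • ρ) ∂gaussianReal 0 1 :=
  integral_map (by fun_prop) hf.aestronglyMeasurable

theorem integrable_lineGaussian_iff (ρ : E) {f : E → ℝ} (hf : Measurable f) :
    Integrable f (lineGaussian ρ : Measure E) ↔
      Integrable (fun z : ℝ => f (z • ρ)) (gaussianReal 0 1) :=
  integrable_map_measure hf.aestronglyMeasurable (by fun_prop)

theorem integrable_lineCoord {ρ : E} (hρ : ρ ≠ 0) :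
    Integrable (lineCoord ρ) (lineGaussian ρ : Measure E) := by
  rw [integrable_lineGaussian_iff ρ (measurable_lineCoord ρ)]
  simpa only [lineCoord_smul hρ, pow_one] using integrable_pow_gaussianReal 0 1 1

theorem integral_lineCoord {ρ : E} (hρ : ρ ≠ 0) :
    ∫ w, lineCoord ρ w ∂(lineGaussian ρ : Measure E) = 0 := by
  rw [integral_lineGaussian ρ (measurable_lineCoord ρ)]
  simp only [lineCoord_smul hρ, integral_id_gaussianReal]

theorem lintegral_smul_add_lineGaussian {ρ : E} (hρ : ρ ≠ 0) (a : ℝ) {f : E → ℝ≥0∞}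
    (hf : Measurable f) :
    ∫⁻ w, f (a • ρ + w) ∂(lineGaussian ρ : Measure E) =
      ∫⁻ w, f w * ENNReal.ofReal (Real.exp (a * lineCoord ρ w - a ^ 2 / 2))
        ∂(lineGaussian ρ : Measure E) := by
  have hmap {h : E → ℝ≥0∞} (hh : Measurable h) :
      ∫⁻ w, h w ∂(lineGaussian ρ : Measure E) = ∫⁻ z, h (z • ρ) ∂gaussianReal 0 1 :=
    lintegral_map hh (by fun_prop)
  rw [hmap (by fun_prop), hmap (by fun_prop)]
  simp only [← add_smul, lineCoord_smul hρ]
  simpa only [sub_zero, NNReal.coe_one, div_one] using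
    lintegral_const_add_gaussianReal 0 one_ne_zero a (f := fun z => f (z • ρ)) (by fun_prop)

variable {m : ℕ}

theorem integrable_pow_apply_lineGaussian (ρ : Vec m) (i : Fin m) (k : ℕ) :
    Integrable (fun w : Vec m => w i ^ k) (lineGaussian ρ : Measure (Vec m)) := by
  rw [integrable_lineGaussian_iff ρ (by fun_prop)]
  simpa only [PiLp.smul_apply, smul_eq_mul, mul_pow] using
    (integrable_pow_gaussianReal 0 1 k).mul_const (ρ i ^ k)

theorem integral_pow_apply_lineGaussian (ρ : Vec m) (i : Fin m) (k : ℕ) :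
    ∫ w, w i ^ k ∂(lineGaussian ρ : Measure (Vec m)) =
      (∫ z, z ^ k ∂gaussianReal 0 1) * ρ i ^ k := by
  rw [integral_lineGaussian ρ (by fun_prop)]
  simp only [PiLp.smul_apply, smul_eq_mul, mul_pow, integral_mul_const]

theorem eventually_lineGaussian_smul_mem_noiseLaws (ρ : Vec m) {σ : ℝ} (hσ : 0 < σ) :
    ∀ᶠ τ : ℝ in 𝓝 0, lineGaussian (τ • ρ) ∈ noiseLaws m σ := by
  have hmoment (i : Fin m) {k : ℕ} (hk : k ≠ 0) : ∀ᶠ τ : ℝ in 𝓝 0,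
      ∫ w, w i ^ k ∂(lineGaussian (τ • ρ) : Measure (Vec m)) ≤ σ ^ k := by
    simp only [integral_pow_apply_lineGaussian, PiLp.smul_apply, smul_eq_mul]
    refine (Continuous.tendsto (by fun_prop) 0).eventually (eventually_le_nhds ?_)
    simpa [hk] using pow_pos hσ k
  filter_upwards [Filter.eventually_all.2 fun i => hmoment i two_ne_zero,
    Filter.eventually_all.2 fun i => hmoment i four_ne_zero] with τ h2 h4 i
  refine ⟨integrable_pow_apply_lineGaussian _ i 4, ?_, h2 i, h4 i⟩
  simpa only [pow_one, integral_id_gaussianReal, zero_mul] using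
    integral_pow_apply_lineGaussian (τ • ρ) i 1

end LineGaussian

section LikelihoodRatio

variable {Ω : Type*} [MeasurableSpace Ω]

theorem one_add_half_sub_le_min_one_exp (x : ℝ) :
    1 + x / 2 - (1 + Real.exp x) / 4 ≤ min 1 (Real.exp x) := by
  have hsq : Real.exp x = Real.exp (x / 2) ^ 2 := by
    rw [← Real.exp_nat_mul]
    congr 1
    push_cast
    ring
  have hlin := Real.add_one_le_exp (x / 2)
  rw [hsq]
  refine le_min ?_ ?_ <;>
    nlinarith [sq_nonneg (Real.exp (x / 2) - 2), sq_nonneg (2 * Real.exp (x / 2) - 1)]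

/-- If `exp Λ` is the density of a law `Q` with respect to `P`, then `-∫ Λ ∂P` is a relative entropy
and the right-hand side is the overlap of the two laws. -/
theorem half_add_half_integral_le_integral_min_one_exp {P : Measure Ω} [IsProbabilityMeasure P]
    {Λ : Ω → ℝ} (hΛ : Integrable Λ P) (hexp : Integrable (fun ω => Real.exp (Λ ω)) P)
    (hone : ∫ ω, Real.exp (Λ ω) ∂P = 1) :
    1 / 2 + (∫ ω, Λ ω ∂P) / 2 ≤ ∫ ω, min 1 (Real.exp (Λ ω)) ∂P := by
  have hone_add : Integrable (fun ω => 1 + Λ ω / 2) P := (integrable_const 1).add (hΛ.div_const 2)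
  have hexp_add : Integrable (fun ω => (1 + Real.exp (Λ ω)) / 4) P :=
    ((integrable_const 1).add hexp).div_const 4
  calc 1 / 2 + (∫ ω, Λ ω ∂P) / 2
      = ∫ ω, (1 + Λ ω / 2 - (1 + Real.exp (Λ ω)) / 4) ∂P := by
        rw [integral_sub hone_add hexp_add, integral_add (integrable_const 1) (hΛ.div_const 2),
          integral_div, integral_div, integral_add (integrable_const 1) hexp, hone, integral_const,
          probReal_univ, one_smul]
        ring
    _ ≤ ∫ ω, min 1 (Real.exp (Λ ω)) ∂P :=
        integral_mono (hone_add.sub hexp_add) ((integrable_const 1).inf hexp)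
          fun ω => one_add_half_sub_le_min_one_exp (Λ ω)

theorem sq_norm_sub_le_two_mul_add {E : Type*} [SeminormedAddCommGroup E] (x y z : E) :
    ‖x - z‖ ^ 2 ≤ 2 * (‖y - x‖ ^ 2 + ‖y - z‖ ^ 2) := by
  have htri := norm_sub_le_norm_sub_add_norm_sub x y z
  rw [norm_sub_rev x y] at htri
  nlinarith [sq_nonneg (‖y - x‖ - ‖y - z‖), norm_nonneg (x - z)]

theorem two_point_lintegral_le {E : Type*} [SeminormedAddCommGroup E] [MeasurableSpace E]
    [OpensMeasurableSpace E] [MeasurableSub E] {P : Measure Ω} {L : Ω → ℝ} {Y : Ω → E}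
    (hY : Measurable Y) (hL : ∀ ω, 0 ≤ L ω) (x₀ x₁ : E) :
    ENNReal.ofReal (‖x₀ - x₁‖ ^ 2 / 2) * ∫⁻ ω, ENNReal.ofReal (min 1 (L ω)) ∂P ≤
      ∫⁻ ω, ENNReal.ofReal (‖Y ω - x₀‖ ^ 2) ∂P +
        ∫⁻ ω, ENNReal.ofReal (‖Y ω - x₁‖ ^ 2) * ENNReal.ofReal (L ω) ∂P := by
  rw [← lintegral_add_left (by fun_prop), ← lintegral_const_mul' _ _ ENNReal.ofReal_ne_top]
  refine lintegral_mono fun ω => ?_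
  rw [← ENNReal.ofReal_mul (by positivity), ← ENNReal.ofReal_mul (by positivity),
    ← ENNReal.ofReal_add (by positivity) (mul_nonneg (by positivity) (hL ω))]
  refine ENNReal.ofReal_le_ofReal ?_
  have hmin : 0 ≤ min 1 (L ω) := le_min zero_le_one (hL ω)
  calc ‖x₀ - x₁‖ ^ 2 / 2 * min 1 (L ω)
      ≤ (‖Y ω - x₀‖ ^ 2 + ‖Y ω - x₁‖ ^ 2) * min 1 (L ω) := by
        gcongr
        linarith [sq_norm_sub_le_two_mul_add x₀ (Y ω) x₁]
    _ = ‖Y ω - x₀‖ ^ 2 * min 1 (L ω) + ‖Y ω - x₁‖ ^ 2 * min 1 (L ω) := by ring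
    _ ≤ ‖Y ω - x₀‖ ^ 2 * 1 + ‖Y ω - x₁‖ ^ 2 * L ω := by
        gcongr
        · exact min_le_left _ _
        · exact min_le_right _ _
    _ = ‖Y ω - x₀‖ ^ 2 + ‖Y ω - x₁‖ ^ 2 * L ω := by rw [mul_one]

end LikelihoodRatio

section Drift

variable {m : ℕ} {S : Type*}

/-- Adds `a p • ρ` to the noise of period `t`. -/
def shiftNoise (ρ : Vec m) (t : ℕ) (a : S × (ℕ → Vec m) → ℝ) (p : S × (ℕ → Vec m)) :
    S × (ℕ → Vec m) :=
  (p.1, Function.update p.2 t (a p • ρ + p.2 t))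

/-- Adds the drift `a i • ρ` to the noise of the periods `i < t`, where each `a i` is evaluated at
the noise sequence to which the drift has been added already. -/
def addDrift (ρ : Vec m) (a : ℕ → S × (ℕ → Vec m) → ℝ) : ℕ → S × (ℕ → Vec m) → S × (ℕ → Vec m)
  | 0 => id
  | t + 1 => shiftNoise ρ t (a t) ∘ addDrift ρ a t

/-- The logarithm of the density, after `t` periods, of the law of the noise with drift `a` with
respect to the law of the noise, when the latter is `lineGaussian ρ` in every period. -/
def driftLogLikelihood (ρ : Vec m) (a : ℕ → S × (ℕ → Vec m) → ℝ) (t : ℕ) (p : S × (ℕ → Vec m)) :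
    ℝ :=
  ∑ i ∈ Finset.range t, (a i p * lineCoord ρ (p.2 i) - a i p ^ 2 / 2)

variable {ρ : Vec m} {a : ℕ → S × (ℕ → Vec m) → ℝ}

theorem fst_addDrift (t : ℕ) (p : S × (ℕ → Vec m)) : (addDrift ρ a t p).1 = p.1 := by
  induction t with
  | zero => rfl
  | succ _ ih => exact ih

theorem snd_addDrift_of_le {t i : ℕ} (hi : t ≤ i) (p : S × (ℕ → Vec m)) :
    (addDrift ρ a t p).2 i = p.2 i := by
  induction t with
  | zero => rfl
  | succ t ih =>
    simp only [addDrift, Function.comp_apply, shiftNoise]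
    rw [Function.update_of_ne (by lia), ih (by lia)]

theorem isNonanticipating_driftLogLikelihood (ha : ∀ i, IsNonanticipating i (a i)) (t : ℕ) :
    IsNonanticipating t (driftLogLikelihood ρ a t) := by
  intro u w w' hw
  refine Finset.sum_congr rfl fun i hi => ?_
  have hit : i < t := Finset.mem_range.1 hi
  simp only [(ha i).mono hit.le u hw, hw i hit]

variable [MeasurableSpace S]

theorem measurable_shiftNoise (ρ : Vec m) (t : ℕ) {a : S × (ℕ → Vec m) → ℝ} (ha : Measurable a) :
    Measurable (shiftNoise ρ t a) := by
  have hupd : Measurable fun q : (ℕ → Vec m) × Vec m => Function.update q.1 t q.2 :=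
    measurable_update'
  exact measurable_fst.prodMk (hupd.comp (measurable_snd.prodMk (by fun_prop)))

theorem measurable_driftLogLikelihood (ham : ∀ i, Measurable (a i)) (t : ℕ) :
    Measurable (driftLogLikelihood ρ a t) := by
  unfold driftLogLikelihood
  fun_prop

variable {ν : Measure S} [IsProbabilityMeasure ν]

theorem lintegral_shiftNoise (hρ : ρ ≠ 0) {t : ℕ} {b : S × (ℕ → Vec m) → ℝ} (hb : Measurable b)
    (hbt : IsNonanticipating t b) {f : S × (ℕ → Vec m) → ℝ≥0∞} (hf : Measurable f) :
    ∫⁻ p, f (shiftNoise ρ t b p) ∂jointLaw ν (lineGaussian ρ) =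
      ∫⁻ p, f p * ENNReal.ofReal (Real.exp (b p * lineCoord ρ (p.2 t) - b p ^ 2 / 2))
        ∂jointLaw ν (lineGaussian ρ) := by
  have hfs : Measurable fun p => f (shiftNoise ρ t b p) := hf.comp (measurable_shiftNoise ρ t hb)
  have hfL : Measurable fun p =>
      f p * ENNReal.ofReal (Real.exp (b p * lineCoord ρ (p.2 t) - b p ^ 2 / 2)) := by fun_prop
  rw [lintegral_jointLaw_eq_lintegral_update ν _ t hfs,
    lintegral_jointLaw_eq_lintegral_update ν _ t hfL]
  refine lintegral_congr fun p => ?_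
  have hslice : Measurable fun z => f (p.1, Function.update p.2 t z) :=
    hf.comp (measurable_const.prodMk (measurable_update p.2))
  simp only [shiftNoise, hbt.apply_update, Function.update_self, Function.update_idem]
  exact lintegral_smul_add_lineGaussian hρ (b p) hslice

theorem lintegral_addDrift (hρ : ρ ≠ 0) (ham : ∀ i, Measurable (a i))
    (ha : ∀ i, IsNonanticipating i (a i)) (t : ℕ) {f : S × (ℕ → Vec m) → ℝ≥0∞}
    (hf : Measurable f) :
    ∫⁻ p, f (addDrift ρ a t p) ∂jointLaw ν (lineGaussian ρ) =
      ∫⁻ p, f p * ENNReal.ofReal (Real.exp (driftLogLikelihood ρ a t p))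
        ∂jointLaw ν (lineGaussian ρ) := by
  induction t generalizing f with
  | zero => simp [addDrift, driftLogLikelihood]
  | succ t ih =>
    have hΛm : Measurable (driftLogLikelihood ρ a t) := measurable_driftLogLikelihood ham t
    have hΛ (p : S × (ℕ → Vec m)) :
        driftLogLikelihood ρ a t (shiftNoise ρ t (a t) p) = driftLogLikelihood ρ a t p :=
      (isNonanticipating_driftLogLikelihood ha t).apply_update p _
    calc ∫⁻ p, f (addDrift ρ a (t + 1) p) ∂jointLaw ν (lineGaussian ρ)
        = ∫⁻ p, f (shiftNoise ρ t (a t) p) *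
            ENNReal.ofReal (Real.exp (driftLogLikelihood ρ a t (shiftNoise ρ t (a t) p)))
            ∂jointLaw ν (lineGaussian ρ) := by
          simp only [hΛ]
          exact ih (hf.comp (measurable_shiftNoise ρ t (ham t)))
      _ = ∫⁻ p, f p * ENNReal.ofReal (Real.exp (driftLogLikelihood ρ a t p)) *
            ENNReal.ofReal (Real.exp (a t p * lineCoord ρ (p.2 t) - a t p ^ 2 / 2))
            ∂jointLaw ν (lineGaussian ρ) :=
          lintegral_shiftNoise hρ (ham t) (ha t)
            (f := fun p => f p * ENNReal.ofReal (Real.exp (driftLogLikelihood ρ a t p)))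
            (by fun_prop)
      _ = ∫⁻ p, f p * ENNReal.ofReal (Real.exp (driftLogLikelihood ρ a (t + 1) p))
            ∂jointLaw ν (lineGaussian ρ) := by
          refine lintegral_congr fun p => ?_
          rw [mul_assoc, ← ENNReal.ofReal_mul (Real.exp_nonneg _), ← Real.exp_add,
            driftLogLikelihood, driftLogLikelihood, Finset.sum_range_succ]

theorem lintegral_exp_driftLogLikelihood (hρ : ρ ≠ 0) (ham : ∀ i, Measurable (a i))
    (ha : ∀ i, IsNonanticipating i (a i)) (t : ℕ) :
    ∫⁻ p, ENNReal.ofReal (Real.exp (driftLogLikelihood ρ a t p)) ∂jointLaw ν (lineGaussian ρ) =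
      1 := by
  simpa using (lintegral_addDrift (ν := ν) hρ ham ha t (f := fun _ => 1) measurable_const).symm

theorem integrable_exp_driftLogLikelihood (hρ : ρ ≠ 0) (ham : ∀ i, Measurable (a i))
    (ha : ∀ i, IsNonanticipating i (a i)) (t : ℕ) :
    Integrable (fun p => Real.exp (driftLogLikelihood ρ a t p)) (jointLaw ν (lineGaussian ρ)) := by
  refine ⟨(measurable_driftLogLikelihood ham t).exp.aestronglyMeasurable, ?_⟩
  rw [hasFiniteIntegral_iff_ofReal (.of_forall fun p => Real.exp_nonneg _),
    lintegral_exp_driftLogLikelihood hρ ham ha t]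
  exact ENNReal.one_lt_top

theorem integral_exp_driftLogLikelihood (hρ : ρ ≠ 0) (ham : ∀ i, Measurable (a i))
    (ha : ∀ i, IsNonanticipating i (a i)) (t : ℕ) :
    ∫ p, Real.exp (driftLogLikelihood ρ a t p) ∂jointLaw ν (lineGaussian ρ) = 1 := by
  rw [integral_eq_lintegral_of_nonneg_ae (.of_forall fun p => Real.exp_nonneg _)
    (measurable_driftLogLikelihood ham t).exp.aestronglyMeasurable,
    lintegral_exp_driftLogLikelihood hρ ham ha t, ENNReal.toReal_one]

theorem integrable_mul_lineCoord_noise (hρ : ρ ≠ 0) {t : ℕ} {b : S × (ℕ → Vec m) → ℝ}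
    (hbm : Measurable b) (hb : IsNonanticipating t b)
    (hbi : Integrable b (jointLaw ν (lineGaussian ρ))) :
    Integrable (fun p => b p * lineCoord ρ (p.2 t)) (jointLaw ν (lineGaussian ρ)) :=
  ((hb.indepFun_noise ν _ hbm).comp measurable_id (measurable_lineCoord ρ)).integrable_mul hbi
    ((measurePreserving_noise_jointLaw ν _ t).integrable_comp_of_integrable
      (integrable_lineCoord hρ))

theorem integral_mul_lineCoord_noise (hρ : ρ ≠ 0) {t : ℕ} {b : S × (ℕ → Vec m) → ℝ}
    (hbm : Measurable b) (hb : IsNonanticipating t b) :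
    ∫ p, b p * lineCoord ρ (p.2 t) ∂jointLaw ν (lineGaussian ρ) = 0 := by
  have hnoise := measurePreserving_noise_jointLaw ν (lineGaussian ρ) t
  have hindep := (hb.indepFun_noise ν (lineGaussian ρ) hbm).comp measurable_id
    (measurable_lineCoord ρ)
  have hcentred : ∫ p, lineCoord ρ (p.2 t) ∂jointLaw ν (lineGaussian ρ) = 0 := by
    rw [← integral_lineCoord hρ, ← hnoise.map_eq, integral_map hnoise.measurable.aemeasurable
      (measurable_lineCoord ρ).aestronglyMeasurable]
  calc ∫ p, b p * lineCoord ρ (p.2 t) ∂jointLaw ν (lineGaussian ρ)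
      = (∫ p, b p ∂jointLaw ν (lineGaussian ρ)) *
          ∫ p, lineCoord ρ (p.2 t) ∂jointLaw ν (lineGaussian ρ) :=
        hindep.integral_fun_mul_eq_mul_integral hbm.aestronglyMeasurable
          ((measurable_lineCoord ρ).comp hnoise.measurable).aestronglyMeasurable
    _ = 0 := by rw [hcentred, mul_zero]

theorem integrable_driftLogLikelihood_term (hρ : ρ ≠ 0) {t : ℕ} {b : S × (ℕ → Vec m) → ℝ}
    (hbm : Measurable b) (hb : IsNonanticipating t b)
    (hb2 : MemLp b 2 (jointLaw ν (lineGaussian ρ))) :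
    Integrable (fun p => b p * lineCoord ρ (p.2 t) - b p ^ 2 / 2)
      (jointLaw ν (lineGaussian ρ)) :=
  (integrable_mul_lineCoord_noise hρ hbm hb (hb2.integrable one_le_two)).sub
    (hb2.integrable_sq.div_const 2)

theorem integral_driftLogLikelihood (hρ : ρ ≠ 0) (ham : ∀ i, Measurable (a i))
    (ha : ∀ i, IsNonanticipating i (a i)) {t : ℕ}
    (hL2 : ∀ i ∈ Finset.range t, MemLp (a i) 2 (jointLaw ν (lineGaussian ρ))) :
    ∫ p, driftLogLikelihood ρ a t p ∂jointLaw ν (lineGaussian ρ) =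
      -(∑ i ∈ Finset.range t, ∫ p, a i p ^ 2 ∂jointLaw ν (lineGaussian ρ)) / 2 := by
  unfold driftLogLikelihood
  rw [integral_finsetSum _ fun i hi =>
    integrable_driftLogLikelihood_term hρ (ham i) (ha i) (hL2 i hi), neg_div, Finset.sum_div,
    ← Finset.sum_neg_distrib]
  refine Finset.sum_congr rfl fun i hi => ?_
  rw [integral_sub (integrable_mul_lineCoord_noise hρ (ham i) (ha i)
    ((hL2 i hi).integrable one_le_two)) ((hL2 i hi).integrable_sq.div_const 2),
    integral_mul_lineCoord_noise hρ (ham i) (ha i), integral_div, zero_sub]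

theorem half_sub_le_integral_min_one_exp_driftLogLikelihood (hρ : ρ ≠ 0)
    (ham : ∀ i, Measurable (a i)) (ha : ∀ i, IsNonanticipating i (a i)) {t : ℕ}
    (hL2 : ∀ i ∈ Finset.range t, MemLp (a i) 2 (jointLaw ν (lineGaussian ρ))) :
    1 / 2 - (∑ i ∈ Finset.range t, ∫ p, a i p ^ 2 ∂jointLaw ν (lineGaussian ρ)) / 4 ≤
      ∫ p, min 1 (Real.exp (driftLogLikelihood ρ a t p)) ∂jointLaw ν (lineGaussian ρ) := by
  have hΛ : Integrable (driftLogLikelihood ρ a t) (jointLaw ν (lineGaussian ρ)) :=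
    integrable_finsetSum _ fun i hi =>
      integrable_driftLogLikelihood_term hρ (ham i) (ha i) (hL2 i hi)
  have hmin := half_add_half_integral_le_integral_min_one_exp hΛ
    (integrable_exp_driftLogLikelihood hρ ham ha t) (integral_exp_driftLogLikelihood hρ ham ha t)
  rw [integral_driftLogLikelihood hρ ham ha hL2] at hmin
  linarith

theorem quarter_le_lintegral_min_one_exp_driftLogLikelihood (hρ : ρ ≠ 0)
    (ham : ∀ i, Measurable (a i)) (ha : ∀ i, IsNonanticipating i (a i)) {t : ℕ}
    (hinfo : ∑ i ∈ Finset.range t,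
      ∫⁻ p, ENNReal.ofReal (a i p ^ 2) ∂jointLaw ν (lineGaussian ρ) ≤ 1) :
    ENNReal.ofReal (1 / 4) ≤
      ∫⁻ p, ENNReal.ofReal (min 1 (Real.exp (driftLogLikelihood ρ a t p)))
        ∂jointLaw ν (lineGaussian ρ) := by
  have hfin (i : ℕ) (hi : i ∈ Finset.range t) :
      ∫⁻ p, ENNReal.ofReal (a i p ^ 2) ∂jointLaw ν (lineGaussian ρ) < ⊤ :=
    ((Finset.single_le_sum (fun _ _ => zero_le) hi).trans hinfo).trans_lt ENNReal.one_lt_top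
  have hL2 (i : ℕ) (hi : i ∈ Finset.range t) : MemLp (a i) 2 (jointLaw ν (lineGaussian ρ)) :=
    (memLp_two_iff_integrable_sq (ham i).aestronglyMeasurable).2
      ⟨((ham i).pow_const 2).aestronglyMeasurable,
        (hasFiniteIntegral_iff_ofReal (.of_forall fun p => sq_nonneg (a i p))).2 (hfin i hi)⟩
  have hsum : ∑ i ∈ Finset.range t, ∫ p, a i p ^ 2 ∂jointLaw ν (lineGaussian ρ) ≤ 1 := by
    rw [Finset.sum_congr rfl fun i _ => integral_eq_lintegral_of_nonneg_ae
      (.of_forall fun p => sq_nonneg (a i p)) ((ham i).pow_const 2).aestronglyMeasurable,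
      ← ENNReal.toReal_sum fun i hi => (hfin i hi).ne]
    exact ENNReal.toReal_le_of_le_ofReal zero_le_one (by simpa using hinfo)
  have hmin : Integrable (fun p => min 1 (Real.exp (driftLogLikelihood ρ a t p)))
      (jointLaw ν (lineGaussian ρ)) :=
    (integrable_const 1).inf (integrable_exp_driftLogLikelihood hρ ham ha t)
  rw [← ofReal_integral_eq_lintegral_ofReal hmin
    (.of_forall fun p => le_min zero_le_one (Real.exp_nonneg _))]
  refine ENNReal.ofReal_le_ofReal ?_
  linarith [half_sub_le_integral_min_one_exp_driftLogLikelihood hρ ham ha hL2]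

end Drift

section Policies

variable {m n : ℕ} {S : Type*} [MeasurableSpace S]

@[fun_prop]
theorem measurable_meanOutput (θ : Param m n) : Measurable (meanOutput θ) := by
  unfold meanOutput
  exact Continuous.measurable (by fun_prop)

theorem measurable_history (μ : DecisionRules m n S) (θ : Param m n) (t : ℕ) :
    Measurable fun p : S × (ℕ → Vec m) => history μ θ p.1 p.2 t := by
  induction t with
  | zero => exact measurable_pi_iff.2 fun i => i.elim0
  | succ t ih =>
    have hinput : Measurable fun p : S × (ℕ → Vec m) => μ.rule t p.1 (history μ θ p.1 p.2 t) :=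
      (μ.measurable_rule t).comp (measurable_fst.prodMk ih)
    refine measurable_pi_iff.2 fun i => Fin.lastCases ?_ (fun j => ?_) i
    · simp only [history, Fin.snoc_last]
      fun_prop
    · simp only [history, Fin.snoc_castSucc]
      exact (measurable_pi_apply j).comp ih

theorem measurable_output (μ e : DecisionRules m n S) (θ : Param m n) (t : ℕ) :
    Measurable fun p : S × (ℕ → Vec m) => output μ e θ p.1 p.2 t :=
  (e.measurable_rule t).comp (measurable_fst.prodMk (measurable_history μ θ t))

theorem isNonanticipating_history (μ : DecisionRules m n S) (θ : Param m n) (t : ℕ) :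
    IsNonanticipating t fun p : S × (ℕ → Vec m) => history μ θ p.1 p.2 t := by
  intro u w w' hw
  induction t with
  | zero => rfl
  | succ t ih =>
    have hhistory : history μ θ u w t = history μ θ u w' t :=
      ih fun i hi => hw i (Set.Iio_subset_Iio t.le_succ hi)
    simp only [history, hhistory, hw t (Nat.lt_succ_self t)]

theorem isNonanticipating_output (μ e : DecisionRules m n S) (θ : Param m n) (t : ℕ) :
    IsNonanticipating t fun p : S × (ℕ → Vec m) => output μ e θ p.1 p.2 t :=
  fun u _ _ hw => congrArg (e.rule t u) (isNonanticipating_history μ θ t u hw)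

variable {θ₀ θ₁ : Param m n} {ρ : Vec m} {g : Vec n → ℝ} {ν : Measure S}

theorem history_addDrift (hθ : ∀ x, meanOutput θ₁ x = meanOutput θ₀ x + g x • ρ)
    (μ : DecisionRules m n S) (t : ℕ) (p : S × (ℕ → Vec m)) :
    history μ θ₀ p.1 (addDrift ρ (fun i q => g (output μ μ θ₀ q.1 q.2 i)) t p).2 t =
      history μ θ₁ p.1 p.2 t := by
  induction t with
  | zero => rfl
  | succ t ih =>
    set q := addDrift ρ (fun i q => g (output μ μ θ₀ q.1 q.2 i)) t p
    have hfst : q.1 = p.1 := fst_addDrift t p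
    have hnoise : q.2 t = p.2 t := snd_addDrift_of_le le_rfl p
    have hpast (z : Vec m) :
        history μ θ₀ p.1 (Function.update q.2 t z) t = history μ θ₁ p.1 p.2 t :=
      ((isNonanticipating_history μ θ₀ t).apply_update (p.1, q.2) z).trans ih
    have hdrift : g (output μ μ θ₀ q.1 q.2 t) = g (μ.rule t p.1 (history μ θ₁ p.1 p.2 t)) := by
      rw [output, hfst, ih]
    change history μ θ₀ p.1 (Function.update q.2 t (g (output μ μ θ₀ q.1 q.2 t) • ρ + q.2 t))
      (t + 1) = _
    simp only [history, hpast, Function.update_self, hdrift, hθ, hnoise, add_assoc]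

theorem output_addDrift (hθ : ∀ x, meanOutput θ₁ x = meanOutput θ₀ x + g x • ρ)
    (μ e : DecisionRules m n S) (t : ℕ) (p : S × (ℕ → Vec m)) :
    output μ e θ₀ p.1 (addDrift ρ (fun i q => g (output μ μ θ₀ q.1 q.2 i)) t p).2 t =
      output μ e θ₁ p.1 p.2 t :=
  congrArg (e.rule t p.1) (history_addDrift hθ μ t p)

/-- The mean squared distance to `x` of the value of the rules `e` at index `t`. -/
def meanSqDist (ν : Measure S) (μ e : DecisionRules m n S) (θ : Param m n)
    (F : ProbabilityMeasure (Vec m)) (t : ℕ) (x : Vec n) : ℝ≥0∞ :=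
  ∫⁻ p, ENNReal.ofReal (‖output μ e θ p.1 p.2 t - x‖ ^ 2) ∂jointLaw ν F

theorem cumulativeMSE_eq_sum_meanSqDist (ystar : Vec m) (ν : Measure S)
    (μ e : DecisionRules m n S) (T : ℕ) (θ : Param m n) (F : ProbabilityMeasure (Vec m)) :
    cumulativeMSE ystar ν μ e T θ F =
      ∑ t ∈ Finset.range T, meanSqDist ν μ e θ F t (optimalInput ystar θ) :=
  lintegral_finsetSum _ fun t _ => by
    have := measurable_output μ e θ t
    fun_prop

theorem ofReal_sq_div_eight_le_meanSqDist_add [IsProbabilityMeasure ν] (hρ : ρ ≠ 0)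
    (hg : Measurable g) (hθ : ∀ x, meanOutput θ₁ x = meanOutput θ₀ x + g x • ρ)
    (μ e : DecisionRules m n S) {t : ℕ}
    (hinfo : ∑ i ∈ Finset.range t, ∫⁻ p, ENNReal.ofReal (g (output μ μ θ₀ p.1 p.2 i) ^ 2)
      ∂jointLaw ν (lineGaussian ρ) ≤ 1) (x₀ x₁ : Vec n) :
    ENNReal.ofReal (‖x₀ - x₁‖ ^ 2 / 8) ≤
      meanSqDist ν μ e θ₀ (lineGaussian ρ) t x₀ + meanSqDist ν μ e θ₁ (lineGaussian ρ) t x₁ := by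
  set a : ℕ → S × (ℕ → Vec m) → ℝ := fun i p => g (output μ μ θ₀ p.1 p.2 i) with ha
  have ham (i : ℕ) : Measurable (a i) := hg.comp (measurable_output μ μ θ₀ i)
  have hpred (i : ℕ) : IsNonanticipating i (a i) :=
    fun u _ _ hw => congrArg g (isNonanticipating_output μ μ θ₀ i u hw)
  have hmeas := measurable_output μ e θ₀ t
  have hchange : meanSqDist ν μ e θ₁ (lineGaussian ρ) t x₁ =
      ∫⁻ p, ENNReal.ofReal (‖output μ e θ₀ p.1 p.2 t - x₁‖ ^ 2) *
        ENNReal.ofReal (Real.exp (driftLogLikelihood ρ a t p)) ∂jointLaw ν (lineGaussian ρ) := by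
    rw [← lintegral_addDrift hρ ham hpred t (by fun_prop)]
    simp only [fst_addDrift, ha, output_addDrift hθ, meanSqDist]
  calc ENNReal.ofReal (‖x₀ - x₁‖ ^ 2 / 8)
      = ENNReal.ofReal (‖x₀ - x₁‖ ^ 2 / 2) * ENNReal.ofReal (1 / 4) := by
        rw [← ENNReal.ofReal_mul (by positivity)]
        congr 1
        ring
    _ ≤ ENNReal.ofReal (‖x₀ - x₁‖ ^ 2 / 2) * ∫⁻ p, ENNReal.ofReal
          (min 1 (Real.exp (driftLogLikelihood ρ a t p))) ∂jointLaw ν (lineGaussian ρ) := by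
        gcongr
        exact quarter_le_lintegral_min_one_exp_driftLogLikelihood hρ ham hpred hinfo
    _ ≤ _ := by
        rw [hchange]
        exact two_point_lintegral_le hmeas (fun p => Real.exp_nonneg _) x₀ x₁

end Policies

section LeastSquares

open scoped InnerProductSpace

theorem exists_pos_mul_sq_norm_le_sq_norm {E F : Type*} [NormedAddCommGroup E] [NormedSpace ℝ E]
    [FiniteDimensional ℝ E] [NormedAddCommGroup F] [NormedSpace ℝ F] {f : E →ₗ[ℝ] F}
    (hf : LinearMap.ker f = ⊥) : ∃ l : ℝ, 0 < l ∧ ∀ x, l * ‖x‖ ^ 2 ≤ ‖f x‖ ^ 2 := by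
  obtain ⟨K, hK, hanti⟩ := f.exists_antilipschitzWith hf
  refine ⟨((K : ℝ) ^ 2)⁻¹, by positivity, fun x => ?_⟩
  have hbound : ‖x‖ ≤ K * ‖f x‖ := by simpa using hanti.le_mul_dist x 0
  rw [inv_mul_le_iff₀ (by positivity), ← mul_pow]
  gcongr

variable {m n : ℕ}

theorem inner_toEuclideanLin_left (A : Matrix (Fin m) (Fin n) ℝ) (x : Vec n) (y : Vec m) :
    ⟪A.toEuclideanLin x, y⟫_ℝ = ⟪x, Aᵀ.toEuclideanLin y⟫_ℝ := by
  rw [← LinearMap.adjoint_inner_right, ← Matrix.toEuclideanLin_conjTranspose_eq_adjoint,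
    Matrix.conjTranspose_eq_transpose_of_trivial]

theorem isUnit_det_transpose_mul_self {A : Matrix (Fin m) (Fin n) ℝ} (hA : A.rank = n) :
    IsUnit (Aᵀ * A).det := by
  rw [← Matrix.isUnit_iff_isUnit_det, ← Matrix.mulVec_surjective_iff_isUnit]
  have hrank : Module.finrank ℝ (LinearMap.range (Aᵀ * A).mulVecLin) =
      Module.finrank ℝ (Fin n → ℝ) := by
    rw [← Matrix.rank, Matrix.rank_transpose_mul_self, hA, Module.finrank_fin_fun]
  exact LinearMap.range_eq_top.1 (Submodule.eq_top_of_finrank_eq hrank)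

theorem ker_toEuclideanLin_eq_bot {A : Matrix (Fin m) (Fin n) ℝ} (hA : A.rank = n) :
    LinearMap.ker A.toEuclideanLin = ⊥ := by
  have hrank : Module.finrank ℝ (LinearMap.range A.toEuclideanLin) = n :=
    (A.rank_eq_finrank_range_toLin (PiLp.basisFun 2 ℝ (Fin m))
      (PiLp.basisFun 2 ℝ (Fin n))).symm.trans hA
  have hnullity := A.toEuclideanLin.finrank_range_add_finrank_ker
  rw [hrank, finrank_euclideanSpace_fin] at hnullity
  exact Submodule.finrank_eq_zero.1 (Nat.add_eq_left.1 hnullity)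

theorem sub_meanOutput_eq (ystar : Vec m) (θ : Param m n) (x z : Vec n) :
    ystar - meanOutput θ x = ystar - meanOutput θ z - θ.1.toEuclideanLin (x - z) := by
  have hmean (x : Vec n) : meanOutput θ x = θ.1.toEuclideanLin x + θ.2 := rfl
  rw [hmean, hmean, map_sub]
  abel

theorem optimalInput_eq_iff (ystar : Vec m) {θ : Param m n} (hθ : θ.1.rank = n) (x : Vec n) :
    optimalInput ystar θ = x ↔
      ∀ p, ⟪θ.1.toEuclideanLin p, ystar - meanOutput θ x⟫_ℝ = 0 := by
  have hunit := isUnit_det_transpose_mul_self hθ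
  have hresidual : θ.1ᵀ.toEuclideanLin (ystar - meanOutput θ x) =
      WithLp.toLp 2 (θ.1ᵀ *ᵥ (ystar - θ.2).ofLp - (θ.1ᵀ * θ.1) *ᵥ x.ofLp) := by
    rw [← Matrix.mulVec_mulVec, ← Matrix.mulVec_sub, meanOutput, add_comm, ← sub_sub]
    rfl
  calc optimalInput ystar θ = x
      ↔ θ.1ᵀ *ᵥ (ystar - θ.2).ofLp = (θ.1ᵀ * θ.1) *ᵥ x.ofLp := by
        constructor
        · rintro rfl
          rw [optimalInput, Matrix.mulVec_mulVec, Matrix.mul_nonsing_inv _ hunit,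
            Matrix.one_mulVec]
        · intro h
          rw [optimalInput, h, Matrix.mulVec_mulVec, Matrix.nonsing_inv_mul _ hunit,
            Matrix.one_mulVec]
    _ ↔ θ.1ᵀ.toEuclideanLin (ystar - meanOutput θ x) = 0 := by
        rw [hresidual, WithLp.toLp_eq_zero, sub_eq_zero]
    _ ↔ ∀ p, ⟪θ.1.toEuclideanLin p, ystar - meanOutput θ x⟫_ℝ = 0 := by
        simp only [inner_toEuclideanLin_left]
        exact ⟨fun h p => by rw [h, inner_zero_right], fun h => inner_self_eq_zero.1 (h _)⟩

theorem stageCost_eq_add_sq_norm {σ : ℝ} (ystar : Vec m) {θ : Param m n} (hθ : θ.1.rank = n)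
    {F : ProbabilityMeasure (Vec m)} (hF : F ∈ noiseLaws m σ) (x : Vec n) :
    stageCost ystar θ F x = stageCost ystar θ F (optimalInput ystar θ) +
      ‖θ.1.toEuclideanLin (x - optimalInput ystar θ)‖ ^ 2 := by
  have hortho := (optimalInput_eq_iff ystar hθ _).1 rfl (x - optimalInput ystar θ)
  rw [stageCost_eq ystar θ hF, stageCost_eq ystar θ hF,
    sub_meanOutput_eq ystar θ x (optimalInput ystar θ), norm_sub_sq_real, real_inner_comm, hortho]
  ring

end LeastSquares

section Perturbation

open scoped InnerProductSpace
open Topology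

variable {m n : ℕ}

/-- The system `θ` with `s ρ vᵀ` added to `A`, and with `b` corrected so that the mean output at
`x₀` does not change. -/
def perturb (θ : Param m n) (ρ : Vec m) (v x₀ : Vec n) (s : ℝ) : Param m n :=
  (θ.1 + s • vecMulVec ρ.ofLp v.ofLp, θ.2 - (s * ⟪v, x₀⟫_ℝ) • ρ)

theorem perturb_zero (θ : Param m n) (ρ : Vec m) (v x₀ : Vec n) : perturb θ ρ v x₀ 0 = θ := by
  simp [perturb]

theorem continuous_perturb (θ : Param m n) (ρ : Vec m) (v x₀ : Vec n) :
    Continuous (perturb θ ρ v x₀) := by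
  unfold perturb
  fun_prop

theorem toEuclideanLin_perturb (θ : Param m n) (ρ : Vec m) (v x₀ : Vec n) (s : ℝ) (x : Vec n) :
    (perturb θ ρ v x₀ s).1.toEuclideanLin x = θ.1.toEuclideanLin x + (s * ⟪v, x⟫_ℝ) • ρ := by
  ext i
  simp [perturb, vecMulVec_mulVec, EuclideanSpace.inner_eq_star_dotProduct, dotProduct_comm,
    mul_assoc, mul_comm]

theorem meanOutput_perturb (θ : Param m n) (ρ : Vec m) (v x₀ : Vec n) (s : ℝ) (x : Vec n) :
    meanOutput (perturb θ ρ v x₀ s) x = meanOutput θ x + (s * ⟪v, x - x₀⟫_ℝ) • ρ := by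
  calc meanOutput (perturb θ ρ v x₀ s) x
      = (perturb θ ρ v x₀ s).1.toEuclideanLin x + (θ.2 - (s * ⟪v, x₀⟫_ℝ) • ρ) := rfl
    _ = θ.1.toEuclideanLin x + θ.2 + (s * ⟪v, x - x₀⟫_ℝ) • ρ := by
        rw [toEuclideanLin_perturb, inner_sub_right]
        module

variable {ystar : Vec m} {θ : Param m n} {ρ : Vec m}

theorem sq_norm_toEuclideanLin_le_perturb (hρ : ∀ p, ⟪θ.1.toEuclideanLin p, ρ⟫_ℝ = 0)
    (v x₀ : Vec n) (s : ℝ) (x : Vec n) :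
    ‖θ.1.toEuclideanLin x‖ ^ 2 ≤ ‖(perturb θ ρ v x₀ s).1.toEuclideanLin x‖ ^ 2 := by
  rw [toEuclideanLin_perturb, norm_add_sq_real, inner_smul_right, hρ]
  linarith [sq_nonneg ‖(s * ⟪v, x⟫_ℝ) • ρ‖]

theorem optimalInput_perturb (hθ : θ.1.rank = n) (hρ : ∀ p, ⟪θ.1.toEuclideanLin p, ρ⟫_ℝ = 0)
    {q v : Vec n} (hv : ∀ p, ⟪v, p⟫_ℝ = ⟪θ.1.toEuclideanLin q, θ.1.toEuclideanLin p⟫_ℝ) {s : ℝ}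
    (hs : (perturb θ ρ v (optimalInput ystar θ) s).1.rank = n) :
    optimalInput ystar (perturb θ ρ v (optimalInput ystar θ) s) = optimalInput ystar θ +
      (s * ⟪ρ, ystar - meanOutput θ (optimalInput ystar θ)⟫_ℝ /
        (1 + s ^ 2 * ‖ρ‖ ^ 2 * ‖θ.1.toEuclideanLin q‖ ^ 2)) • q := by
  set x₀ := optimalInput ystar θ
  set r := ystar - meanOutput θ x₀ with hr
  set c := s * ⟪ρ, r⟫_ℝ / (1 + s ^ 2 * ‖ρ‖ ^ 2 * ‖θ.1.toEuclideanLin q‖ ^ 2)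
  have hc : c * (1 + s ^ 2 * ‖ρ‖ ^ 2 * ‖θ.1.toEuclideanLin q‖ ^ 2) = s * ⟪ρ, r⟫_ℝ :=
    div_mul_cancel₀ _ (by positivity)
  have hrortho : ∀ p, ⟪θ.1.toEuclideanLin p, r⟫_ℝ = 0 := (optimalInput_eq_iff ystar hθ x₀).1 rfl
  have hρq : ⟪ρ, θ.1.toEuclideanLin q⟫_ℝ = 0 := by rw [real_inner_comm, hρ]
  have hresidual : ystar - meanOutput (perturb θ ρ v x₀ s) (x₀ + c • q) =
      r - c • θ.1.toEuclideanLin q - (s * c * ‖θ.1.toEuclideanLin q‖ ^ 2) • ρ := by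
    rw [meanOutput_perturb, ← sub_sub, sub_meanOutput_eq ystar θ _ x₀, add_sub_cancel_left,
      map_smul, inner_smul_right, hv, real_inner_self_eq_norm_sq, ← hr, mul_assoc]
  refine (optimalInput_eq_iff ystar hs _).2 fun p => ?_
  rw [hresidual, toEuclideanLin_perturb, hv]
  simp only [inner_add_left, inner_sub_right, inner_smul_left, inner_smul_right, hrortho, hρ,
    hρq, real_inner_self_eq_norm_sq, RCLike.conj_to_real]
  rw [real_inner_comm (θ.1.toEuclideanLin q)]
  linear_combination (-⟪θ.1.toEuclideanLin q, θ.1.toEuclideanLin p⟫_ℝ) * hc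

theorem mul_le_norm_optimalInput_perturb_sub (hθ : θ.1.rank = n)
    (hρ : ∀ p, ⟪θ.1.toEuclideanLin p, ρ⟫_ℝ = 0)
    (hρr : 0 ≤ ⟪ρ, ystar - meanOutput θ (optimalInput ystar θ)⟫_ℝ) {q v : Vec n}
    (hv : ∀ p, ⟪v, p⟫_ℝ = ⟪θ.1.toEuclideanLin q, θ.1.toEuclideanLin p⟫_ℝ) {s : ℝ} (hs₀ : 0 ≤ s)
    (hs₁ : s ≤ 1) (hs : (perturb θ ρ v (optimalInput ystar θ) s).1.rank = n) :
    ⟪ρ, ystar - meanOutput θ (optimalInput ystar θ)⟫_ℝ /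
        (1 + ‖ρ‖ ^ 2 * ‖θ.1.toEuclideanLin q‖ ^ 2) * ‖q‖ * s ≤
      ‖optimalInput ystar (perturb θ ρ v (optimalInput ystar θ) s) - optimalInput ystar θ‖ := by
  calc _ = s * ⟪ρ, ystar - meanOutput θ (optimalInput ystar θ)⟫_ℝ /
        (1 + 1 * ‖ρ‖ ^ 2 * ‖θ.1.toEuclideanLin q‖ ^ 2) * ‖q‖ := by ring
    _ ≤ s * ⟪ρ, ystar - meanOutput θ (optimalInput ystar θ)⟫_ℝ /
        (1 + s ^ 2 * ‖ρ‖ ^ 2 * ‖θ.1.toEuclideanLin q‖ ^ 2) * ‖q‖ := by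
        gcongr
        exact pow_le_one₀ hs₀ hs₁
    _ = _ := by
        rw [optimalInput_perturb hθ hρ hv hs, add_sub_cancel_left, norm_smul,
          Real.norm_of_nonneg (by positivity)]

theorem exists_mem_interior_meanOutput_optimalInput_ne (hmn : n < m) (ystar : Vec m)
    {D : Set (Vec n)} {Θ : Set (Param m n)}
    (hint : (interior (admissibleParams ystar D Θ)).Nonempty) :
    ∃ θ ∈ interior (admissibleParams ystar D Θ),
      meanOutput θ (optimalInput ystar θ) ≠ ystar := by
  obtain ⟨θ, hθ⟩ := hint
  by_cases! hfit : meanOutput θ (optimalInput ystar θ) ≠ ystar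
  · exact ⟨θ, hθ, hfit⟩
  -- An exact fit is destroyed by moving `b` off the range of `A`, orthogonally to it.
  obtain ⟨u, hu, hu0⟩ := Submodule.exists_mem_ne_zero_of_ne_bot
    (LinearMap.ker_ne_bot_of_finrank_lt (f := θ.1ᵀ.toEuclideanLin) (by simpa using hmn))
  have hcont : Continuous fun ε : ℝ => ((θ.1, θ.2 - ε • u) : Param m n) := by fun_prop
  have hnear : ∀ᶠ ε in 𝓝 (0 : ℝ), (θ.1, θ.2 - ε • u) ∈ interior (admissibleParams ystar D Θ) :=
    hcont.continuousAt.eventually (isOpen_interior.mem_nhds (by simpa using hθ))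
  obtain ⟨ε, hε, hε0⟩ := ((hnear.filter_mono nhdsWithin_le_nhds).and
    (eventually_mem_nhdsWithin (s := {(0 : ℝ)}ᶜ))).exists
  have hresidual :
      ystar - meanOutput (θ.1, θ.2 - ε • u) (optimalInput ystar θ) = ε • u := by
    nth_rewrite 1 [← hfit]
    simp only [meanOutput]
    abel
  have hoptimal : optimalInput ystar (θ.1, θ.2 - ε • u) = optimalInput ystar θ := by
    refine (optimalInput_eq_iff ystar (interior_subset hε).2.1 _).2 fun p => ?_
    rw [hresidual, inner_smul_right, inner_toEuclideanLin_left, LinearMap.mem_ker.1 hu,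
      inner_zero_right, mul_zero]
  refine ⟨_, hε, fun hfit' => smul_ne_zero hε0 hu0 ?_⟩
  rw [← hresidual, ← hoptimal, hfit', sub_self]

end Perturbation

section HardCurve

open scoped InnerProductSpace
open Topology

variable {m n : ℕ} {ystar ρ : Vec m} {v : Vec n} {s₀ : ℝ}

/-- A curve of systems that are hard to tell apart: for `s ∈ [0, s₀]` the optimal inputs of `θ s`
and `θ 0` are at least `c * s` apart, whereas the mean outputs differ only along `ρ`, by at most
`s` times a multiple of the distance of the input from the optimal input of `θ 0`. -/
structure IsHardCurve (ystar : Vec m) (ρ : Vec m) (v : Vec n) (s₀ c : ℝ) (θ : ℝ → Param m n) :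
    Prop where
  direction_ne_zero : ρ ≠ 0
  length_pos : 0 < s₀
  speed_pos : 0 < c
  meanOutput_eq : ∀ s ∈ Set.Icc 0 s₀, ∀ x, meanOutput (θ s) x =
    meanOutput (θ 0) x + (s * ⟪v, x - optimalInput ystar (θ 0)⟫_ℝ) • ρ
  speed_mul_le : ∀ s ∈ Set.Icc 0 s₀,
    c * s ≤ ‖optimalInput ystar (θ 0) - optimalInput ystar (θ s)‖

theorem isHardCurve_perturb {θ : Param m n} (hθ : θ.1.rank = n)
    (hρ : ∀ p, ⟪θ.1.toEuclideanLin p, ρ⟫_ℝ = 0)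
    (hρr : 0 < ⟪ρ, ystar - meanOutput θ (optimalInput ystar θ)⟫_ℝ) {q : Vec n} (hq : q ≠ 0)
    (hv : ∀ p, ⟪v, p⟫_ℝ = ⟪θ.1.toEuclideanLin q, θ.1.toEuclideanLin p⟫_ℝ) (hs₀ : 0 < s₀)
    (hs₁ : s₀ ≤ 1)
    (hrank : ∀ s ∈ Set.Icc 0 s₀, (perturb θ ρ v (optimalInput ystar θ) s).1.rank = n) :
    IsHardCurve ystar ρ v s₀
      (⟪ρ, ystar - meanOutput θ (optimalInput ystar θ)⟫_ℝ /
        (1 + ‖ρ‖ ^ 2 * ‖θ.1.toEuclideanLin q‖ ^ 2) * ‖q‖)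
      (perturb θ ρ v (optimalInput ystar θ)) where
  direction_ne_zero := by
    rintro rfl
    simp at hρr
  length_pos := hs₀
  speed_pos := by
    have := norm_pos_iff.2 hq
    positivity
  meanOutput_eq s _ x := by rw [perturb_zero, meanOutput_perturb]
  speed_mul_le s hs := by
    rw [perturb_zero, norm_sub_rev]
    exact mul_le_norm_optimalInput_perturb_sub hθ hρ hρr.le hv hs.1 (hs.2.trans hs₁) (hrank s hs)

theorem exists_isHardCurve (hn : 0 < n) (hmn : n < m) (ystar : Vec m) {D : Set (Vec n)}
    {Θ : Set (Param m n)} (hint : (interior (admissibleParams ystar D Θ)).Nonempty) {σ : ℝ}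
    (hσ : 0 < σ) :
    ∃ (ρ : Vec m) (v : Vec n) (s₀ c : ℝ) (θ : ℝ → Param m n), IsHardCurve ystar ρ v s₀ c θ ∧
      lineGaussian ρ ∈ noiseLaws m σ ∧
      (∀ s ∈ Set.Icc 0 s₀, θ s ∈ admissibleParams ystar D Θ) ∧
      ∃ l : ℝ, 0 < l ∧
        ∀ s ∈ Set.Icc 0 s₀, ∀ x, l * ‖x‖ ^ 2 ≤ ‖(θ s).1.toEuclideanLin x‖ ^ 2 := by
  obtain ⟨θ, hθ, hfit⟩ := exists_mem_interior_meanOutput_optimalInput_ne hmn ystar hint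
  have hrank : θ.1.rank = n := (interior_subset hθ).2.1
  set x₀ := optimalInput ystar θ
  set r := ystar - meanOutput θ x₀
  have hr0 : r ≠ 0 := sub_ne_zero.2 hfit.symm
  obtain ⟨τ, hnoise, hτ : 0 < τ⟩ := (((eventually_lineGaussian_smul_mem_noiseLaws r hσ).filter_mono
    nhdsWithin_le_nhds).and (eventually_mem_nhdsWithin (s := Set.Ioi 0))).exists
  have : Nonempty (Fin n) := ⟨⟨0, hn⟩⟩
  obtain ⟨q, hq⟩ := exists_ne (0 : Vec n)
  -- With `v = Aᵀ A q` the optimal input of the perturbed system moves in the direction `q`.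
  set v := θ.1ᵀ.toEuclideanLin (θ.1.toEuclideanLin q) with hv
  have hvq (p : Vec n) : ⟪v, p⟫_ℝ = ⟪θ.1.toEuclideanLin q, θ.1.toEuclideanLin p⟫_ℝ := by
    rw [real_inner_comm, hv, ← inner_toEuclideanLin_left, real_inner_comm]
  have hortho (p : Vec n) : ⟪θ.1.toEuclideanLin p, τ • r⟫_ℝ = 0 := by
    rw [inner_smul_right, (optimalInput_eq_iff ystar hrank x₀).1 rfl p, mul_zero]
  have hρr : 0 < ⟪τ • r, r⟫_ℝ := by
    rw [real_inner_smul_left, real_inner_self_eq_norm_sq]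
    positivity
  have hnear : ∀ᶠ s in 𝓝 0, perturb θ (τ • r) v x₀ s ∈ interior (admissibleParams ystar D Θ) :=
    (continuous_perturb θ (τ • r) v x₀).continuousAt.eventually
      (isOpen_interior.mem_nhds (by rwa [perturb_zero]))
  obtain ⟨δ, hδ, hball⟩ := Metric.eventually_nhds_iff.1 hnear
  have hadm (s : ℝ) (hs : s ∈ Set.Icc 0 (min 1 (δ / 2))) :
      perturb θ (τ • r) v x₀ s ∈ admissibleParams ystar D Θ := by
    refine interior_subset (hball ?_)
    rw [dist_zero_right, Real.norm_of_nonneg hs.1]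
    linarith [hs.2.trans (min_le_right _ _)]
  obtain ⟨l, hl, hcoercive⟩ := exists_pos_mul_sq_norm_le_sq_norm (ker_toEuclideanLin_eq_bot hrank)
  exact ⟨τ • r, v, min 1 (δ / 2), _, perturb θ (τ • r) v x₀,
    isHardCurve_perturb hrank hortho hρr hq hvq (by positivity) (min_le_left _ _)
      fun s hs => (hadm s hs).2.1, hnoise, hadm, l, hl, fun s _ x =>
    (hcoercive x).trans (sq_norm_toEuclideanLin_le_perturb hortho v x₀ s x)⟩

end HardCurve

section LowerBound

open scoped InnerProductSpace

theorem ofReal_mul_le_mul_of_forall_le_one {a K r₀ N : ℝ} (ha : 0 < a) (hK : 0 < K) (hr₀ : 0 < r₀)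
    (hN : 0 ≤ N) {X Y : ℝ≥0∞} (hX : ENNReal.ofReal (a * r₀) ≤ X)
    (hY : ENNReal.ofReal (a * r₀) ≤ Y)
    (hXY : ∀ r ∈ Set.Icc 0 r₀, ENNReal.ofReal (r * K) * X ≤ 1 → ENNReal.ofReal (a * r * N) ≤ Y) :
    ENNReal.ofReal (a * min K⁻¹ (a * r₀ ^ 2) * N) ≤ Y * X := by
  have hpos : 0 < ENNReal.ofReal (a * r₀) := ENNReal.ofReal_pos.2 (by positivity)
  rcases eq_or_ne X ⊤ with rfl | hXtop
  · rw [ENNReal.mul_top (hpos.trans_le hY).ne']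
    exact le_top
  obtain ⟨x, hx, rfl⟩ : ∃ x : ℝ, 0 ≤ x ∧ ENNReal.ofReal x = X :=
    ⟨X.toReal, ENNReal.toReal_nonneg, ENNReal.ofReal_toReal hXtop⟩
  have hax : a * r₀ ≤ x := (ENNReal.ofReal_le_ofReal_iff hx).1 hX
  have hx₀ : 0 < x := (by positivity : 0 < a * r₀).trans_le hax
  -- The largest admissible `r` is of order `1 / x`.
  have hr : min K⁻¹ (a * r₀ ^ 2) / x ≤ r₀ := by
    rw [div_le_iff₀ hx₀]
    calc min K⁻¹ (a * r₀ ^ 2) ≤ r₀ * (a * r₀) := (min_le_right _ _).trans_eq (by ring)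
      _ ≤ r₀ * x := by gcongr
  have hinfo : ENNReal.ofReal (min K⁻¹ (a * r₀ ^ 2) / x * K) * ENNReal.ofReal x ≤ 1 := by
    rw [← ENNReal.ofReal_mul (by positivity), ENNReal.ofReal_le_one, mul_right_comm,
      div_mul_cancel₀ _ hx₀.ne', ← le_div_iff₀ hK, one_div]
    exact min_le_left _ _
  calc ENNReal.ofReal (a * min K⁻¹ (a * r₀ ^ 2) * N)
      = ENNReal.ofReal (a * (min K⁻¹ (a * r₀ ^ 2) / x) * N) * ENNReal.ofReal x := by
        rw [← ENNReal.ofReal_mul (by positivity)]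
        congr 1
        field_simp
    _ ≤ Y * ENNReal.ofReal x := by
        gcongr
        exact hXY _ ⟨by positivity, hr⟩ hinfo

theorem ofReal_sqrt_mul_sqrt_le {a b : ℝ} (ha : 0 ≤ a) (hb : 0 ≤ b) {X : ℝ≥0∞}
    (h : ENNReal.ofReal (a * b) ≤ X * X) : ENNReal.ofReal (√a * √b) ≤ X := by
  refine le_of_not_gt fun hlt => (ENNReal.mul_lt_mul hlt hlt).not_ge ?_
  rwa [← ENNReal.ofReal_mul (by positivity), mul_mul_mul_comm, Real.mul_self_sqrt ha,
    Real.mul_self_sqrt hb]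

variable {m n : ℕ} {S : Type*} [MeasurableSpace S]

theorem cumulativeMSE_mono (ystar : Vec m) (ν : Measure S) (μ e : DecisionRules m n S) {t T : ℕ}
    (h : t ≤ T) (θ : Param m n) (F : ProbabilityMeasure (Vec m)) :
    cumulativeMSE ystar ν μ e t θ F ≤ cumulativeMSE ystar ν μ e T θ F := by
  simp only [cumulativeMSE_eq_sum_meanSqDist]
  exact Finset.sum_le_sum_of_subset (Finset.range_subset_range.2 h)

theorem sum_lintegral_sq_mul_inner_le (ystar : Vec m) (ν : Measure S) (μ : DecisionRules m n S)
    (θ : Param m n) (F : ProbabilityMeasure (Vec m)) (t : ℕ) (s : ℝ) (v : Vec n) :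
    ∑ i ∈ Finset.range t, ∫⁻ p, ENNReal.ofReal
        ((s * ⟪v, output μ μ θ p.1 p.2 i - optimalInput ystar θ⟫_ℝ) ^ 2) ∂jointLaw ν F ≤
      ENNReal.ofReal (s ^ 2 * ‖v‖ ^ 2) * cumulativeMSE ystar ν μ μ t θ F := by
  rw [cumulativeMSE_eq_sum_meanSqDist, Finset.mul_sum]
  refine Finset.sum_le_sum fun i _ => ?_
  rw [meanSqDist, ← lintegral_const_mul' _ _ ENNReal.ofReal_ne_top]
  refine lintegral_mono fun p => ?_
  rw [← ENNReal.ofReal_mul (by positivity), ← mul_pow, ← mul_pow, mul_assoc]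
  refine ENNReal.ofReal_le_ofReal (sq_le_sq.2 ?_)
  rw [abs_mul, abs_mul, abs_of_nonneg (by positivity : 0 ≤ ‖v‖ * _)]
  gcongr
  exact abs_real_inner_le_norm _ _

/-- The largest cumulative error of the estimates `e` on the curve of systems `θ s`,
`s ∈ [0, s₀]`, for a fixed noise law. -/
def worstMSEAlong (ystar : Vec m) (θ : ℝ → Param m n) (s₀ : ℝ) (F : ProbabilityMeasure (Vec m))
    (ν : Measure S) (μ e : DecisionRules m n S) (T : ℕ) : ℝ≥0∞ :=
  ⨆ s ∈ Set.Icc 0 s₀, cumulativeMSE ystar ν μ e T (θ s) F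

variable {ystar ρ : Vec m} {v : Vec n} {s₀ c : ℝ} {θ : ℝ → Param m n} {ν : Measure S}

theorem cumulativeMSE_le_worstMSEAlong {s : ℝ} (hs : s ∈ Set.Icc 0 s₀)
    (F : ProbabilityMeasure (Vec m)) (μ e : DecisionRules m n S) (T : ℕ) :
    cumulativeMSE ystar ν μ e T (θ s) F ≤ worstMSEAlong ystar θ s₀ F ν μ e T :=
  le_iSup₂_of_le s hs le_rfl

namespace IsHardCurve

variable [IsProbabilityMeasure ν]

theorem ofReal_mul_sq_le_meanSqDist_add (hcurve : IsHardCurve ystar ρ v s₀ c θ)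
    (μ e : DecisionRules m n S) (t : ℕ) {s : ℝ} (hs : s ∈ Set.Icc 0 s₀)
    (hinfo : ENNReal.ofReal (s ^ 2 * ‖v‖ ^ 2) *
      cumulativeMSE ystar ν μ μ t (θ 0) (lineGaussian ρ) ≤ 1) :
    ENNReal.ofReal (c ^ 2 / 8 * s ^ 2) ≤
      meanSqDist ν μ e (θ 0) (lineGaussian ρ) t (optimalInput ystar (θ 0)) +
        meanSqDist ν μ e (θ s) (lineGaussian ρ) t (optimalInput ystar (θ s)) := by
  have hspeed : c ^ 2 / 8 * s ^ 2 ≤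
      ‖optimalInput ystar (θ 0) - optimalInput ystar (θ s)‖ ^ 2 / 8 := by
    have hsq := pow_le_pow_left₀ (mul_nonneg hcurve.speed_pos.le hs.1)
      (hcurve.speed_mul_le s hs) 2
    linarith [mul_pow c s 2]
  exact (ENNReal.ofReal_le_ofReal hspeed).trans <| ofReal_sq_div_eight_le_meanSqDist_add
    hcurve.direction_ne_zero (by fun_prop) (hcurve.meanOutput_eq s hs) μ e
    ((sum_lintegral_sq_mul_inner_le ystar ν μ (θ 0) (lineGaussian ρ) t s v).trans hinfo) _ _

theorem ofReal_mul_le_worstMSEAlong (hcurve : IsHardCurve ystar ρ v s₀ c θ)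
    (μ e : DecisionRules m n S) (T : ℕ) {s : ℝ} (hs : s ∈ Set.Icc 0 s₀)
    (hinfo : ENNReal.ofReal (s ^ 2 * ‖v‖ ^ 2) *
      cumulativeMSE ystar ν μ μ T (θ 0) (lineGaussian ρ) ≤ 1) :
    ENNReal.ofReal (c ^ 2 / 16 * s ^ 2 * ↑(T + 1)) ≤
      worstMSEAlong ystar θ s₀ (lineGaussian ρ) ν μ e (T + 1) := by
  have hinfo_le (t : ℕ) (ht : t ∈ Finset.range (T + 1)) : ENNReal.ofReal (s ^ 2 * ‖v‖ ^ 2) *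
      cumulativeMSE ystar ν μ μ t (θ 0) (lineGaussian ρ) ≤ 1 :=
    (mul_le_mul_right (cumulativeMSE_mono ystar ν μ μ (Finset.mem_range_succ_iff.1 ht) _ _)
      _).trans hinfo
  refine (ENNReal.mul_le_mul_iff_right two_ne_zero ENNReal.ofNat_ne_top).1 ?_
  calc 2 * ENNReal.ofReal (c ^ 2 / 16 * s ^ 2 * ↑(T + 1))
      = ∑ _t ∈ Finset.range (T + 1), ENNReal.ofReal (c ^ 2 / 8 * s ^ 2) := by
        rw [Finset.sum_const, Finset.card_range, nsmul_eq_mul, ← ENNReal.ofReal_natCast,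
          ← ENNReal.ofReal_ofNat 2, ← ENNReal.ofReal_mul (by positivity),
          ← ENNReal.ofReal_mul (by positivity)]
        congr 1
        ring
    _ ≤ cumulativeMSE ystar ν μ e (T + 1) (θ 0) (lineGaussian ρ) +
          cumulativeMSE ystar ν μ e (T + 1) (θ s) (lineGaussian ρ) := by
        simp only [cumulativeMSE_eq_sum_meanSqDist, ← Finset.sum_add_distrib]
        exact Finset.sum_le_sum fun t ht =>
          hcurve.ofReal_mul_sq_le_meanSqDist_add μ e t hs (hinfo_le t ht)
    _ ≤ 2 * worstMSEAlong ystar θ s₀ (lineGaussian ρ) ν μ e (T + 1) := by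
        rw [two_mul]
        exact add_le_add
          (cumulativeMSE_le_worstMSEAlong (Set.left_mem_Icc.2 hcurve.length_pos.le) _ _ _ _)
          (cumulativeMSE_le_worstMSEAlong hs _ _ _ _)

theorem ofReal_le_worstMSEAlong_succ (hcurve : IsHardCurve ystar ρ v s₀ c θ)
    (μ e : DecisionRules m n S) (T : ℕ) :
    ENNReal.ofReal (c ^ 2 / 16 * s₀ ^ 2) ≤
      worstMSEAlong ystar θ s₀ (lineGaussian ρ) ν μ e (T + 1) := by
  -- No information has been collected before the first output, so the whole curve may be used.
  have hfirst := hcurve.ofReal_mul_le_worstMSEAlong (ν := ν) μ e 0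
    (Set.right_mem_Icc.2 hcurve.length_pos.le) (by simp [cumulativeMSE])
  rw [zero_add, Nat.cast_one, mul_one] at hfirst
  exact hfirst.trans (iSup₂_mono fun s _ => cumulativeMSE_mono ystar ν μ e (by lia) _ _)

theorem ofReal_mul_le_worstMSEAlong_mul (hcurve : IsHardCurve ystar ρ v s₀ c θ)
    (μ e : DecisionRules m n S) (T : ℕ) :
    ENNReal.ofReal
        (c ^ 2 / 16 * min (1 + ‖v‖ ^ 2)⁻¹ (c ^ 2 / 16 * (s₀ ^ 2) ^ 2) * T) ≤
      worstMSEAlong ystar θ s₀ (lineGaussian ρ) ν μ e T *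
        worstMSEAlong ystar θ s₀ (lineGaussian ρ) ν μ μ T := by
  have hc := hcurve.speed_pos
  have hs₀ := hcurve.length_pos
  cases T with
  | zero => simp
  | succ T =>
    refine ofReal_mul_le_mul_of_forall_le_one (by positivity) (by positivity) (by positivity)
      (Nat.cast_nonneg _) (hcurve.ofReal_le_worstMSEAlong_succ μ μ T)
      (hcurve.ofReal_le_worstMSEAlong_succ μ e T) fun r hr hinfo => ?_
    rw [← Real.sq_sqrt hr.1]
    refine hcurve.ofReal_mul_le_worstMSEAlong μ e T
      ⟨Real.sqrt_nonneg r, Real.sqrt_le_iff.2 ⟨hs₀.le, hr.2⟩⟩ (le_trans ?_ hinfo)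
    rw [Real.sq_sqrt hr.1]
    gcongr
    · exact hr.1
    · linarith
    · exact (cumulativeMSE_mono ystar ν μ μ T.le_succ _ _).trans
        (cumulativeMSE_le_worstMSEAlong (Set.left_mem_Icc.2 hs₀.le) _ _ _ _)

end IsHardCurve

theorem mul_cumulativeMSE_le_regret {σ : ℝ} (ystar : Vec m) (ν : Measure S)
    (μ : DecisionRules m n S) (T : ℕ) {θ : Param m n} (hθ : θ.1.rank = n)
    {F : ProbabilityMeasure (Vec m)} (hF : F ∈ noiseLaws m σ) {l : ℝ} (hl : 0 ≤ l)
    (hcoercive : ∀ x, l * ‖x‖ ^ 2 ≤ ‖θ.1.toEuclideanLin x‖ ^ 2) :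
    ENNReal.ofReal l * cumulativeMSE ystar ν μ μ T θ F ≤ regret ystar ν μ T θ F := by
  rw [cumulativeMSE, regret, ← lintegral_const_mul' _ _ ENNReal.ofReal_ne_top]
  refine lintegral_mono fun p => ?_
  rw [← ENNReal.ofReal_sum_of_nonneg fun _ _ => by positivity, ← ENNReal.ofReal_mul hl,
    ← Finset.sum_sub_distrib, Finset.mul_sum]
  refine ENNReal.ofReal_le_ofReal (Finset.sum_le_sum fun t _ => ?_)
  rw [stageCost_eq_add_sq_norm ystar hθ hF (output μ μ θ p.1 p.2 t), add_sub_cancel_left]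
  exact hcoercive _

section WorstCase

variable {D : Set (Vec n)} {Θ : Set (Param m n)} {σ : ℝ} {F : ProbabilityMeasure (Vec m)}

theorem worstMSEAlong_le_worstEstimationMSE
    (hadm : ∀ s ∈ Set.Icc 0 s₀, θ s ∈ admissibleParams ystar D Θ) (hF : F ∈ noiseLaws m σ)
    (μ e : DecisionRules m n S) (T : ℕ) :
    worstMSEAlong ystar θ s₀ F ν μ e T ≤ worstEstimationMSE ystar D Θ σ ν μ e T :=
  iSup₂_le fun s hs => le_iSup₂_of_le (θ s) (hadm s hs) (le_iSup₂_of_le F hF le_rfl)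

theorem mul_worstMSEAlong_le_worstRegret
    (hadm : ∀ s ∈ Set.Icc 0 s₀, θ s ∈ admissibleParams ystar D Θ) (hF : F ∈ noiseLaws m σ)
    {l : ℝ} (hl : 0 ≤ l)
    (hcoercive : ∀ s ∈ Set.Icc 0 s₀, ∀ x, l * ‖x‖ ^ 2 ≤ ‖(θ s).1.toEuclideanLin x‖ ^ 2)
    (μ : DecisionRules m n S) (T : ℕ) :
    ENNReal.ofReal l * worstMSEAlong ystar θ s₀ F ν μ μ T ≤ worstRegret ystar D Θ σ ν μ T := by
  simp only [worstMSEAlong, ENNReal.mul_iSup]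
  exact iSup₂_le fun s hs => le_iSup₂_of_le (θ s) (hadm s hs) (le_iSup₂_of_le F hF
    (mul_cumulativeMSE_le_regret ystar ν μ T (hadm s hs).2.1 hF hl (hcoercive s hs)))

end WorstCase

end LowerBound

end

end AffineRegulation

open AffineRegulation in
theorem mainTheorem5_general (m n : ℕ) (hn : 0 < n) (hmn : n < m) (ystar : Vec m)
    (D : Set (Vec n)) (Θ : Set (Param m n))
    (hint : (interior (admissibleParams ystar D Θ)).Nonempty) (σ : ℝ) (hσ : 0 < σ) :
    ∃ C C' C'' : ℝ, 0 < C ∧ 0 < C' ∧ 0 < C'' ∧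
      ∀ (S : Type*) [MeasurableSpace S] (ν : Measure S) [IsProbabilityMeasure ν]
        (μ : DecisionRules m n S) (T : ℕ),
        (∀ e : DecisionRules m n S, ENNReal.ofReal (C * T) ≤
          worstEstimationMSE ystar D Θ σ ν μ e T * worstInputMSE ystar D Θ σ ν μ T) ∧
        ENNReal.ofReal (C' * √(T : ℝ)) ≤ worstInputMSE ystar D Θ σ ν μ T ∧
        ENNReal.ofReal (C'' * √(T : ℝ)) ≤ worstRegret ystar D Θ σ ν μ T := by
  obtain ⟨ρ, v, s₀, c, θ, hcurve, hnoise, hadm, l, hl, hcoercive⟩ :=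
    exists_isHardCurve hn hmn ystar hint hσ
  have hc := hcurve.speed_pos
  have hs₀ := hcurve.length_pos
  set C : ℝ := c ^ 2 / 16 * min (1 + ‖v‖ ^ 2)⁻¹ (c ^ 2 / 16 * (s₀ ^ 2) ^ 2)
  have hC : 0 < C := by positivity
  refine ⟨C, √C, l * √C, hC, by positivity, by positivity, fun S _ ν _ μ T => ?_⟩
  have hmse (e : DecisionRules m n S) :=
    worstMSEAlong_le_worstEstimationMSE (ν := ν) hadm hnoise μ e T
  have hproduct (e : DecisionRules m n S) := hcurve.ofReal_mul_le_worstMSEAlong_mul (ν := ν) μ e T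
  have hsqrt := ofReal_sqrt_mul_sqrt_le hC.le T.cast_nonneg (hproduct μ)
  refine ⟨fun e => (hproduct e).trans (mul_le_mul' (hmse e) (hmse μ)), hsqrt.trans (hmse μ), ?_⟩
  calc ENNReal.ofReal (l * √C * √(T : ℝ)) = ENNReal.ofReal l * ENNReal.ofReal (√C * √(T : ℝ)) := by
        rw [mul_assoc, ENNReal.ofReal_mul hl.le]
    _ ≤ ENNReal.ofReal l * worstMSEAlong ystar θ s₀ (lineGaussian ρ) ν μ μ T := by gcongr
    _ ≤ worstRegret ystar D Θ σ ν μ T :=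
        mul_worstMSEAlong_le_worstRegret hadm hnoise hl.le hcoercive μ T

theorem mainTheorem5 (m n : ℕ) (hn : 0 < n) (hmn : n < m)
    (ystar : AffineRegulation.Vec m)
    (D : Set (AffineRegulation.Vec n)) (hD : IsCompact D) (hDconv : Convex ℝ D)
    (Θ : Set (AffineRegulation.Param m n)) (hΘ : IsCompact Θ)
    (hint : (interior (AffineRegulation.admissibleParams ystar D Θ)).Nonempty)
    (σ : ℝ) (hσ : 0 < σ) :
    ∃ C C' C'' : ℝ, 0 < C ∧ 0 < C' ∧ 0 < C'' ∧
      ∀ (S : Type*) [MeasurableSpace S] (ν : Measure S) [IsProbabilityMeasure ν]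
        (μ : AffineRegulation.DecisionRules m n S) (T : ℕ),
        (∀ e : AffineRegulation.DecisionRules m n S,
          ENNReal.ofReal (C * T) ≤
            AffineRegulation.worstEstimationMSE ystar D Θ σ ν μ e T *
              AffineRegulation.worstInputMSE ystar D Θ σ ν μ T) ∧
        ENNReal.ofReal (C' * √(T : ℝ)) ≤ AffineRegulation.worstInputMSE ystar D Θ σ ν μ T ∧
        ENNReal.ofReal (C'' * √(T : ℝ)) ≤ AffineRegulation.worstRegret ystar D Θ σ ν μ T :=
  mainTheorem5_general m n hn hmn ystar D Θ hint σ hσ
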